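/- **Definitions.** Let $d\in\mathbf N$, $s>1$. *Spaces.* For $A>0$ and compact $K\subset\mathbf R^d$ put $\|\varphi\|_{s,A,K}=\sup_{\beta\in\mathbf N^d}\sup_{x\in K}\frac{A^{|\beta|}}{\beta!^s}|\partial^\beta\varphi(x)|$. Let $\mathcal E^{(s)}(\mathbf R^d)$ be the space of $\varphi\in C^\infty(\mathbf R^d)$ with $\|\varphi\|_{s,A,K}<\infty$ for all $A,K$, and, for $X\subseteq\mathbf R^d$ open, let $\mathcal D^{(s)}(X)$ be the space of $\varphi\in\mathcal E^{(s)}(\mathbf R^d)$ with compact support contained in $X$. $(\mathcal D^{(s)})'(\mathbf R^d)$ is the space of linear functionals $f$ on $\mathcal D^{(s)}(\mathbf R^d)$ such that for every compact $K$ there are $A,C>0$ with $|\langle f,\varphi\rangle|\le C\|\varphi\|_{s,A,K}$ whenever $\operatorname{supp}\varphi\subseteq K$; $(\mathcal E^{(s)})'(\mathbf R^d)$ is the space of linear functionals $u$ on $\mathcal E^{(s)}(\mathbf R^d)$ with $|\langle u,g\rangle|\le C\|g\|_{s,A,K}$ for all $g$ and some $A,C>0$ and some compact $K$. For $f\in(\mathcal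 D^{(s)})'(\mathbf R^d)$ and $\varphi\in\mathcal D^{(s)}(X)$ the product $\varphi f\in(\mathcal E^{(s)})'(\mathbf R^d)\subseteq(\mathcal D^{(s)})'(\mathbf R^d)$ is $\langle\varphi f,g\rangle=\langle f,\varphi g\rangle$. For $u\in(\mathcal E^{(s)})'(\mathbf R^d)$ put $\widehat u(\xi)=(2\pi)^{-d/2}\langle u,e^{-i\langle\cdot,\xi\rangle}\rangle$. *Weights.* $\mathscr M_{\{s\}}(\mathbf R^{2d})$ is the set of non-negative measurable functions $\omega$ on $\mathbf R^{2d}$ for which there are $c>0$ and a function $v\ge0$ on $\mathbf R^{2d}$ such that $v(z+w)\le v(z)v(w)$, $v(z)\le Ce^{k|z|^{1/s}}$ for some $C,k>0$, and $\omega(z+w)\le c\,v(z)\,\omega(w)$, for all $z,w$. *Wave-front sets.* Let $q\in[1,\infty]$, $\omega\in\mathscr M_{\{s\}}(\mathbf R^{2d})$, and fix a reference point $x\in\mathbf R^d$. For $u\in(\mathcal E^{(s)})'(\mathbf R^d)$ let $\Sigma_{\mathscr FL^q_{(\omega)}}(u)$ be the set of $\xi\in\mathbf R^d\setminus0$ such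 that $\|\widehat u\;\omega(x,\cdot)\|_{L^q(\Gamma)}=\infty$ for every open cone $\Gamma\subseteq\mathbf R^d\setminus0$ containing $\xi$. For $X\subseteq\mathbf R^d$ open and $f\in(\mathcal D^{(s)})'(\mathbf R^d)$ let $\mathrm{WF}_{\mathscr FL^q_{(\omega)}}(f)$ be the set of $(x_0,\xi_0)\in X\times(\mathbf R^d\setminus0)$ such that $\xi_0\in\Sigma_{\mathscr FL^q_{(\omega)}}(\varphi f)$ for every $\varphi\in\mathcal D^{(s)}(X)$ with $\varphi(x_0)\ne0$. **Theorem.** Let $s>1$, $q,r\in[1,\infty]$ with $r\le q$, let $X\subseteq\mathbf R^d$ be open, and let $\omega,\vartheta\in\mathscr M_{\{s\}}(\mathbf R^{2d})$ satisfy $\omega\le c\,\vartheta$ on $\mathbf R^{2d}$ for some constant $c>0$. Then for every $f\in(\mathcal D^{(s)})'(\mathbf R^d)$ and every $\varphi\in\mathcal D^{(s)}(X)$, $$\mathrm{WF}_{\mathscr FL^q_{(\omega)}}(\varphi f)\subseteq\mathrm{WF}_{\mathscr FL^r_{(\vartheta)}}(f),$$ and moreover $$\mathrm{WF}_{\mathscr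 FL^q_{(\omega)}}(f)\subseteq\mathrm{WF}_{\mathscr FL^r_{(\vartheta)}}(f),$$ that is, the wave-front sets decrease in $q$ and increase with the weight. Here the wave-front sets on the two sides may be formed with different reference points $x,y\in\mathbf R^d$. -/

import Mathlib

open MeasureTheory Set
open scoped ENNReal NNReal

namespace UltraWF

/-- Euclidean space `ℝ^d`. -/
abbrev Rd (d : ℕ) : Type := EuclideanSpace ℝ (Fin d)

/-! ### Gevrey norms -/

section Norms

variable {d : ℕ}

/-- The partial derivative `∂^β φ (x)` for a multi-index `β`: the `|β|`-th derivative of `φ` at `x`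
applied to the vectors of the standard basis, the vector `e_j` being repeated `β_j` times. -/
noncomputable def pderiv (β : Fin d → ℕ) (φ : Rd d → ℂ) (x : Rd d) : ℂ :=
  iteratedFDeriv ℝ (∑ j, β j) φ x
    (fun i => EuclideanSpace.single (finSigmaFinEquiv.symm i).1 (1 : ℝ))

/-- The factor `A^{|β|} / β!^s`. -/
noncomputable def gevreyFactor (s A : ℝ) (β : Fin d → ℕ) : ℝ :=
  A ^ (∑ j, β j) / ((∏ j, (β j).factorial : ℕ) : ℝ) ^ s

/-- The norm `‖φ‖_{s,A,K} = sup_β sup_{x ∈ K} A^{|β|} / β!^s * |∂^β φ (x)|`, with values in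
`[0,∞]`. -/
noncomputable def gevreyNorm (s A : ℝ) (K : Set (Rd d)) (φ : Rd d → ℂ) : ℝ≥0∞ :=
  ⨆ β : Fin d → ℕ, ⨆ x ∈ K, ENNReal.ofReal (gevreyFactor s A β * ‖pderiv β φ x‖)

theorem gevreyFactor_pos {s A : ℝ} (hA : 0 < A) (β : Fin d → ℕ) : 0 < gevreyFactor s A β := by
  have h : (0 : ℝ) < ((∏ j, (β j).factorial : ℕ) : ℝ) := by
    exact_mod_cast Finset.prod_pos fun j _ => Nat.factorial_pos _
  unfold gevreyFactor
  positivity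

theorem gevreyNorm_le_ofReal_iff {s A : ℝ} {K : Set (Rd d)} {φ : Rd d → ℂ} {C : ℝ} (hC : 0 ≤ C) :
    gevreyNorm s A K φ ≤ ENNReal.ofReal C ↔
      ∀ β : Fin d → ℕ, ∀ x ∈ K, gevreyFactor s A β * ‖pderiv β φ x‖ ≤ C := by
  simp only [gevreyNorm, iSup_le_iff, ENNReal.ofReal_le_ofReal_iff hC]

theorem gevreyNorm_lt_top_iff {s A : ℝ} {K : Set (Rd d)} {φ : Rd d → ℂ} :
    gevreyNorm s A K φ < ⊤ ↔
      ∃ C : ℝ, 0 ≤ C ∧ ∀ β : Fin d → ℕ, ∀ x ∈ K, gevreyFactor s A β * ‖pderiv β φ x‖ ≤ C := by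
  constructor
  · intro h
    refine ⟨(gevreyNorm s A K φ).toReal, ENNReal.toReal_nonneg, ?_⟩
    rw [← gevreyNorm_le_ofReal_iff ENNReal.toReal_nonneg, ENNReal.ofReal_toReal h.ne]
  · rintro ⟨C, hC, h⟩
    exact ((gevreyNorm_le_ofReal_iff hC).2 h).trans_lt ENNReal.ofReal_lt_top

theorem pderiv_add {φ ψ : Rd d → ℂ} (hφ : ContDiff ℝ (⊤ : ℕ∞) φ) (hψ : ContDiff ℝ (⊤ : ℕ∞) ψ)
    (β : Fin d → ℕ) (x : Rd d) : pderiv β (φ + ψ) x = pderiv β φ x + pderiv β ψ x := by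
  unfold pderiv
  rw [iteratedFDeriv_add (i := ∑ j, β j) ((hφ.of_le (by exact_mod_cast le_top)))
    ((hψ.of_le (by exact_mod_cast le_top)))]
  rfl

theorem pderiv_smul {φ : Rd d → ℂ} (hφ : ContDiff ℝ (⊤ : ℕ∞) φ) (c : ℂ)
    (β : Fin d → ℕ) (x : Rd d) : pderiv β (c • φ) x = c * pderiv β φ x := by
  unfold pderiv
  rw [iteratedFDeriv_const_smul_apply ((hφ.of_le (by exact_mod_cast le_top)).contDiffAt)]
  rfl

theorem pderiv_zero (β : Fin d → ℕ) (x : Rd d) : pderiv β (0 : Rd d → ℂ) x = 0 := by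
  have h := pderiv_smul (d := d) (φ := 0) contDiff_const 0 β x
  simpa using h

theorem pderiv_eq_zero {φ : Rd d → ℂ} {x : Rd d} (hx : x ∉ tsupport φ) (β : Fin d → ℕ) :
    pderiv β φ x = 0 := by
  have h : iteratedFDeriv ℝ (∑ j, β j) φ x = 0 := by
    by_contra h
    exact hx (support_iteratedFDeriv_subset _ h)
  simp [pderiv, h]

theorem gevreyNorm_zero (s A : ℝ) (K : Set (Rd d)) : gevreyNorm s A K 0 = 0 := by
  simp [gevreyNorm, pderiv_zero]

theorem gevreyNorm_add_lt_top {s A : ℝ} (hA : 0 < A) {K : Set (Rd d)} {φ ψ : Rd d → ℂ}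
    (hφ : ContDiff ℝ (⊤ : ℕ∞) φ) (hψ : ContDiff ℝ (⊤ : ℕ∞) ψ) (h1 : gevreyNorm s A K φ < ⊤)
    (h2 : gevreyNorm s A K ψ < ⊤) : gevreyNorm s A K (φ + ψ) < ⊤ := by
  rw [gevreyNorm_lt_top_iff] at *
  obtain ⟨C, hC, h1⟩ := h1
  obtain ⟨D, hD, h2⟩ := h2
  refine ⟨C + D, by positivity, fun β x hx => ?_⟩
  rw [pderiv_add hφ hψ]
  have := gevreyFactor_pos (s := s) hA β
  calc _ ≤ gevreyFactor s A β * (‖pderiv β φ x‖ + ‖pderiv β ψ x‖) := by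
        gcongr; exact norm_add_le _ _
    _ ≤ C + D := by rw [mul_add]; exact add_le_add (h1 β x hx) (h2 β x hx)

theorem gevreyNorm_smul_lt_top {s A : ℝ} {K : Set (Rd d)} {φ : Rd d → ℂ}
    (hφ : ContDiff ℝ (⊤ : ℕ∞) φ) (c : ℂ) (h1 : gevreyNorm s A K φ < ⊤) :
    gevreyNorm s A K (c • φ) < ⊤ := by
  rw [gevreyNorm_lt_top_iff] at *
  obtain ⟨C, hC, h1⟩ := h1
  refine ⟨‖c‖ * C, by positivity, fun β x hx => ?_⟩
  rw [pderiv_smul hφ, norm_mul, mul_left_comm]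
  exact mul_le_mul_of_nonneg_left (h1 β x hx) (norm_nonneg _)

/-- Outside the support nothing is added to the norm. -/
theorem gevreyNorm_le_of_tsupport_subset {s A : ℝ} {K L : Set (Rd d)} {φ : Rd d → ℂ}
    (h : tsupport φ ⊆ K) : gevreyNorm s A L φ ≤ gevreyNorm s A K φ := by
  refine iSup_le fun β => iSup₂_le fun x _ => ?_
  by_cases hx : x ∈ K
  · exact le_iSup_of_le β (le_iSup₂_of_le x hx le_rfl)
  · simp [pderiv_eq_zero (fun h' => hx (h h')) β]

/-! ### Products -/

/-! Symmetry of the higher derivatives of a smooth function. -/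

theorem fderiv_iteratedFDeriv_apply {E F : Type*} [NormedAddCommGroup E] [NormedSpace ℝ E]
    [NormedAddCommGroup F] [NormedSpace ℝ F] {f : E → F} (hf : ContDiff ℝ (⊤ : ℕ∞) f) (n : ℕ)
    (u : Fin n → E) (x a : E) :
    fderiv ℝ (fun y => iteratedFDeriv ℝ n f y u) x a = fderiv ℝ (iteratedFDeriv ℝ n f) x a u := by
  have h : DifferentiableAt ℝ (iteratedFDeriv ℝ n f) x :=
    (hf.differentiable_iteratedFDeriv (by exact_mod_cast WithTop.coe_lt_top n)) x
  have h2 := ((ContinuousMultilinearMap.apply ℝ (fun _ : Fin n => E) F u).hasFDerivAt.comp x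
    h.hasFDerivAt).fderiv
  have h3 := DFunLike.congr_fun h2 a
  exact h3

theorem iteratedFDeriv_adjacent_swap {E F : Type*} [NormedAddCommGroup E] [NormedSpace ℝ E]
    [NormedAddCommGroup F] [NormedSpace ℝ F] {f : E → F} (hf : ContDiff ℝ (⊤ : ℕ∞) f) (n : ℕ) :
    ∀ (i : Fin n) (x : E) (v : Fin (n + 1) → E),
      iteratedFDeriv ℝ (n + 1) f x (v ∘ Equiv.swap i.castSucc i.succ) =
        iteratedFDeriv ℝ (n + 1) f x v := by
  induction n with
  | zero => exact fun i => i.elim0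
  | succ n ih =>
    intro i x v
    induction i using Fin.cases with
    | zero =>
      have key : ∀ w : Fin (n + 2) → E, iteratedFDeriv ℝ (n + 2) f x w =
          fderiv ℝ (fderiv ℝ (fun y => iteratedFDeriv ℝ n f y (Fin.tail (Fin.tail w)))) x
            (w 0) (w 1) := by
        intro w
        have hh : ContDiff ℝ (⊤ : ℕ∞) (fun y => iteratedFDeriv ℝ n f y (Fin.tail (Fin.tail w))) :=
          (ContinuousMultilinearMap.apply ℝ (fun _ : Fin n => E) F _).contDiff.comp
            (hf.iteratedFDeriv_right (i := n) (m := (⊤ : ℕ∞)) (by exact_mod_cast le_top))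
        have hd : DifferentiableAt ℝ
            (fderiv ℝ (fun y => iteratedFDeriv ℝ n f y (Fin.tail (Fin.tail w)))) x :=
          ((hh.fderiv_right (m := (⊤ : ℕ∞)) (by exact_mod_cast le_top)).differentiable
            (by simp)) x
        rw [iteratedFDeriv_succ_apply_left, ← fderiv_iteratedFDeriv_apply hf]
        have e : (fun y => iteratedFDeriv ℝ (n + 1) f y (Fin.tail w)) = fun y =>
            fderiv ℝ (fun y => iteratedFDeriv ℝ n f y (Fin.tail (Fin.tail w))) y (w 1) := by
          funext y
          rw [iteratedFDeriv_succ_apply_left, ← fderiv_iteratedFDeriv_apply hf]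
          rfl
        rw [e]
        have h3 := DFunLike.congr_fun ((ContinuousLinearMap.apply ℝ F (w 1)).hasFDerivAt.comp x
          hd.hasFDerivAt).fderiv (w 0)
        exact h3
      rw [key, key]
      have t : Fin.tail (Fin.tail (v ∘ Equiv.swap (Fin.castSucc (0 : Fin (n + 1)))
          (Fin.succ 0))) = Fin.tail (Fin.tail v) := by
        funext k
        simp only [Fin.tail, Function.comp]
        rw [Equiv.swap_apply_of_ne_of_ne] <;> simp [Fin.ext_iff]
      rw [t]
      have hh : ContDiff ℝ (⊤ : ℕ∞) (fun y => iteratedFDeriv ℝ n f y (Fin.tail (Fin.tail v))) :=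
          (ContinuousMultilinearMap.apply ℝ (fun _ : Fin n => E) F _).contDiff.comp
            (hf.iteratedFDeriv_right (i := n) (m := (⊤ : ℕ∞)) (by exact_mod_cast le_top))
      have hs := (hh.contDiffAt (x := x)).isSymmSndFDerivAt
        (by rw [minSmoothness_of_isRCLikeNormedField]; exact WithTop.coe_le_coe.2 (le_top : (2 : ℕ∞) ≤ ⊤))
      have a0 : (v ∘ Equiv.swap (Fin.castSucc (0 : Fin (n + 1))) (Fin.succ 0)) 0 = v 1 := by
        simp
      have a1 : (v ∘ Equiv.swap (Fin.castSucc (0 : Fin (n + 1))) (Fin.succ 0)) 1 = v 0 := by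
        simp
      rw [a0, a1]
      exact hs.eq _ _
    | succ j =>
      rw [iteratedFDeriv_succ_apply_left, iteratedFDeriv_succ_apply_left,
        ← fderiv_iteratedFDeriv_apply hf, ← fderiv_iteratedFDeriv_apply hf]
      have t : Fin.tail (v ∘ Equiv.swap j.succ.castSucc j.succ.succ) =
          Fin.tail v ∘ Equiv.swap j.castSucc j.succ := by
        funext k
        simp only [Fin.tail, Function.comp, Fin.castSucc_succ]
        congr 1
        rw [Equiv.swap_apply_def, Equiv.swap_apply_def]
        simp only [Fin.succ_inj]
        split_ifs <;> rfl
      have a0 : (v ∘ Equiv.swap j.succ.castSucc j.succ.succ) 0 = v 0 := by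
        simp only [Function.comp]
        rw [Equiv.swap_apply_of_ne_of_ne] <;> simp [Fin.ext_iff]
      rw [t, a0]
      congr 2
      funext y
      exact ih j y (Fin.tail v)

theorem iteratedFDeriv_comp_perm {E F : Type*} [NormedAddCommGroup E] [NormedSpace ℝ E]
    [NormedAddCommGroup F] [NormedSpace ℝ F] {f : E → F} (hf : ContDiff ℝ (⊤ : ℕ∞) f) {n : ℕ}
    (σ : Equiv.Perm (Fin n)) (x : E) (v : Fin n → E) :
    iteratedFDeriv ℝ n f x (v ∘ σ) = iteratedFDeriv ℝ n f x v := by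
  cases n with
  | zero => congr 1; exact Subsingleton.elim _ _
  | succ n =>
    have hσ : σ ∈ Submonoid.closure
        (Set.range fun i : Fin n => Equiv.swap i.castSucc i.succ) := by
      rw [Equiv.Perm.mclosure_swap_castSucc_succ]; trivial
    induction hσ using Submonoid.closure_induction generalizing v with
    | mem σ h =>
      obtain ⟨i, rfl⟩ := h
      exact iteratedFDeriv_adjacent_swap hf n i x v
    | one => rfl
    | mul σ τ _ _ h1 h2 =>
      have : v ∘ (σ * τ : Equiv.Perm (Fin (n + 1))) = (v ∘ σ) ∘ τ := rfl
      rw [this, h2, h1]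

theorem iteratedFDeriv_reindex {φ : Rd d → ℂ} (hφ : ContDiff ℝ (⊤ : ℕ∞) φ) (x : Rd d) {n m : ℕ}
    (σ : Fin n ≃ Fin m) (v : Fin m → Rd d) :
    iteratedFDeriv ℝ n φ x (fun i => v (σ i)) = iteratedFDeriv ℝ m φ x v := by
  obtain rfl : n = m := by simpa using Fintype.card_congr σ
  exact iteratedFDeriv_comp_perm hφ σ x v

/-- Derivatives along basis vectors in any order are partial derivatives for a multi-index. -/
theorem iteratedFDeriv_basis {φ : Rd d → ℂ} (hφ : ContDiff ℝ (⊤ : ℕ∞) φ) (x : Rd d) {n : ℕ}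
    (J : Fin n → Fin d) : ∃ β : Fin d → ℕ, ∑ j, β j = n ∧
      iteratedFDeriv ℝ n φ x (fun i => EuclideanSpace.single (J i) (1 : ℝ)) = pderiv β φ x := by
  classical
  let β : Fin d → ℕ := fun j => Fintype.card {i // J i = j}
  let σ : Fin n ≃ Fin (∑ j, β j) :=
    (Equiv.sigmaFiberEquiv J).symm.trans
      ((Equiv.sigmaCongrRight fun j => Fintype.equivFin {i // J i = j}).trans finSigmaFinEquiv)
  have hσ : ∀ i, (finSigmaFinEquiv.symm (σ i)).1 = J i := by
    intro i
    simp [σ, Equiv.sigmaFiberEquiv]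
  refine ⟨β, ?_, ?_⟩
  · simpa using (Fintype.card_congr σ).symm
  · unfold pderiv
    rw [← iteratedFDeriv_reindex hφ x σ]
    simp only [hσ]

theorem norm_iteratedFDeriv_le_of_pderiv {φ : Rd d → ℂ} (hφ : ContDiff ℝ (⊤ : ℕ∞) φ) (x : Rd d) {n : ℕ}
    {M : ℝ} (hM : 0 ≤ M) (h : ∀ β : Fin d → ℕ, ∑ j, β j = n → ‖pderiv β φ x‖ ≤ M) :
    ‖iteratedFDeriv ℝ n φ x‖ ≤ (d : ℝ) ^ n * M := by
  classical
  refine ContinuousMultilinearMap.opNorm_le_bound (by positivity) fun m => ?_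
  have hm : m = fun i => ∑ j, (m i j) • EuclideanSpace.single j (1 : ℝ) := by
    funext i
    ext k
    simp [Finset.sum_apply, Pi.single_apply]
  conv_lhs => rw [hm]
  rw [ContinuousMultilinearMap.map_sum]
  calc _ ≤ ∑ J : Fin n → Fin d, (∏ i, ‖m i‖) * M := by
        refine norm_sum_le_of_le _ fun J _ => ?_
        rw [ContinuousMultilinearMap.map_smul_univ, norm_smul, norm_prod]
        obtain ⟨β, hβ, hJ⟩ := iteratedFDeriv_basis hφ x J
        rw [hJ]
        gcongr
        · exact PiLp.norm_apply_le _ _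
        · exact h β hβ
    _ = (d : ℝ) ^ n * M * ∏ i, ‖m i‖ := by
        simp [Finset.sum_const, Finset.card_univ]
        ring

theorem norm_pderiv_le (β : Fin d → ℕ) (φ : Rd d → ℂ) (x : Rd d) :
    ‖pderiv β φ x‖ ≤ ‖iteratedFDeriv ℝ (∑ j, β j) φ x‖ := by
  refine (ContinuousMultilinearMap.le_opNorm _ _).trans ?_
  simp

theorem prod_factorial_le (β : Fin d → ℕ) : ∏ j, (β j).factorial ≤ (∑ j, β j).factorial :=
  Nat.le_of_dvd (Nat.factorial_pos _) (Nat.prod_factorial_dvd_factorial_sum _ _)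

theorem factorial_sum_le (β : Fin d → ℕ) : (∑ j, β j).factorial ≤ d ^ (∑ j, β j) * ∏ j, (β j).factorial := by
  classical
  have h1 := Nat.multinomial_spec Finset.univ β
  have h2 : Nat.multinomial Finset.univ β ≤ d ^ (∑ j, β j) := by
    have h := Finset.sum_pow_eq_sum_piAntidiag (Finset.univ : Finset (Fin d))
      (fun _ => (1 : ℕ)) (∑ j, β j)
    simp only [Finset.sum_const, Finset.card_univ, Fintype.card_fin, smul_eq_mul, mul_one,
      one_pow, Finset.prod_const_one, Nat.cast_id] at h
    rw [h]
    exact Finset.single_le_sum (f := fun k => Nat.multinomial Finset.univ k)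
      (fun _ _ => Nat.zero_le _) (by simp)
  rw [← h1, mul_comm]
  exact Nat.mul_le_mul_right _ h2

/-- Bounds on all partial derivatives at a point give bounds on the norm of the derivative. -/
theorem norm_iteratedFDeriv_le_of_gevrey {s A C : ℝ} (hs : 0 ≤ s) (hA : 0 < A) (hC : 0 ≤ C)
    {φ : Rd d → ℂ} (hφ : ContDiff ℝ (⊤ : ℕ∞) φ) {x : Rd d}
    (h : ∀ β : Fin d → ℕ, gevreyFactor s A β * ‖pderiv β φ x‖ ≤ C) (n : ℕ) :
    ‖iteratedFDeriv ℝ n φ x‖ ≤ C * (d / A) ^ n * (n.factorial : ℝ) ^ s := by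
  have key := norm_iteratedFDeriv_le_of_pderiv hφ x (n := n) (M := C / A ^ n * (n.factorial : ℝ) ^ s)
    (by positivity) (fun β hβ => ?_)
  · refine key.trans_eq ?_
    rw [div_pow]
    ring
  · have h1 := h β
    have hP : (0 : ℝ) < ((∏ j, (β j).factorial : ℕ) : ℝ) := by
      exact_mod_cast Finset.prod_pos fun j _ => Nat.factorial_pos _
    have hle : ((∏ j, (β j).factorial : ℕ) : ℝ) ^ s ≤ (n.factorial : ℝ) ^ s := by
      refine Real.rpow_le_rpow hP.le ?_ hs
      rw [← hβ]
      exact_mod_cast prod_factorial_le β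
    unfold gevreyFactor at h1
    rw [hβ, div_mul_eq_mul_div, div_le_iff₀ (by positivity)] at h1
    rw [div_mul_eq_mul_div, le_div_iff₀ (by positivity), mul_comm]
    exact h1.trans (by gcongr)

/-- The constant relating the norms of the factors to the norm of a product. -/
noncomputable def productConst (d : ℕ) (s : ℝ) : ℝ := 2 * (d + 1 : ℝ) * (d + 1 : ℝ) ^ s

theorem productConst_pos (d : ℕ) (s : ℝ) : 0 < productConst d s := by
  unfold productConst
  positivity

/-- Bounds for a product at a point. -/
theorem gevrey_mul_le {s A C D : ℝ} (hs : 0 ≤ s) (hA : 0 < A) (hC : 0 ≤ C) (hD : 0 ≤ D)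
    {φ ψ : Rd d → ℂ} (hφ : ContDiff ℝ (⊤ : ℕ∞) φ) (hψ : ContDiff ℝ (⊤ : ℕ∞) ψ) {x : Rd d}
    (h1 : ∀ β : Fin d → ℕ, gevreyFactor s (productConst d s * A) β * ‖pderiv β φ x‖ ≤ C)
    (h2 : ∀ β : Fin d → ℕ, gevreyFactor s (productConst d s * A) β * ‖pderiv β ψ x‖ ≤ D)
    (β : Fin d → ℕ) : gevreyFactor s A β * ‖pderiv β (φ * ψ) x‖ ≤ C * D := by
  have hB : 0 < productConst d s * A := mul_pos (productConst_pos d s) hA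
  set B := productConst d s * A with hBdef
  set n := ∑ j, β j with hn
  have hP : (0 : ℝ) < ((∏ j, (β j).factorial : ℕ) : ℝ) := by
    exact_mod_cast Finset.prod_pos fun j _ => Nat.factorial_pos _
  have e1 : ‖pderiv β (φ * ψ) x‖ ≤ C * D * (2 * (d / B)) ^ n * (n.factorial : ℝ) ^ s := by
    refine (norm_pderiv_le β _ x).trans ?_
    have hmul := norm_iteratedFDeriv_mul_le hφ hψ x (n := n) (by exact_mod_cast le_top)
    refine hmul.trans ?_
    calc _ ≤ ∑ i ∈ Finset.range (n + 1),
          (n.choose i : ℝ) * (C * D * (d / B) ^ n * (n.factorial : ℝ) ^ s) := by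
          refine Finset.sum_le_sum fun i hi => ?_
          have hi' : i ≤ n := by simpa [Nat.lt_succ_iff] using hi
          have a1 := norm_iteratedFDeriv_le_of_gevrey hs hB hC hφ h1 i
          have a2 := norm_iteratedFDeriv_le_of_gevrey hs hB hD hψ h2 (n - i)
          have a3 : (i.factorial : ℝ) ^ s * ((n - i).factorial : ℝ) ^ s ≤ (n.factorial : ℝ) ^ s := by
            rw [← Real.mul_rpow (by positivity) (by positivity)]
            refine Real.rpow_le_rpow (by positivity) ?_ hs
            exact_mod_cast Nat.le_of_dvd (Nat.factorial_pos _)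
              (Nat.factorial_mul_factorial_dvd_factorial hi')
          rw [mul_assoc]
          refine mul_le_mul_of_nonneg_left ?_ (Nat.cast_nonneg _)
          calc _ ≤ (C * (d / B) ^ i * (i.factorial : ℝ) ^ s) *
                  (D * (d / B) ^ (n - i) * ((n - i).factorial : ℝ) ^ s) := by gcongr
            _ = C * D * ((d / B) ^ i * (d / B) ^ (n - i)) *
                  ((i.factorial : ℝ) ^ s * ((n - i).factorial : ℝ) ^ s) := by ring
            _ ≤ _ := by
                rw [← pow_add, Nat.add_sub_cancel' hi']
                gcongr
      _ = C * D * (2 * (d / B)) ^ n * (n.factorial : ℝ) ^ s := by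
          rw [← Finset.sum_mul]
          have : (∑ i ∈ Finset.range (n + 1), (n.choose i : ℝ)) = 2 ^ n := by
            exact_mod_cast Nat.sum_range_choose n
          rw [this, mul_pow]
          ring
  have e2 : (n.factorial : ℝ) ^ s ≤ (((d : ℝ) + 1) ^ s) ^ n * ((∏ j, (β j).factorial : ℕ) : ℝ) ^ s := by
    rw [← Real.rpow_natCast, ← Real.rpow_mul (by positivity), mul_comm s, Real.rpow_mul
      (by positivity), Real.rpow_natCast, ← Real.mul_rpow (by positivity) (by positivity)]
    refine Real.rpow_le_rpow (by positivity) ?_ hs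
    calc ((n.factorial : ℕ) : ℝ) ≤ (d : ℝ) ^ n * ((∏ j, (β j).factorial : ℕ) : ℝ) := by
          exact_mod_cast factorial_sum_le β
      _ ≤ _ := by gcongr; linarith
  have e3 : A * (2 * (d / B) * ((d : ℝ) + 1) ^ s) ≤ 1 := by
    have hB' : A = B / productConst d s := by
      rw [hBdef]; field_simp [(productConst_pos d s).ne']
    rw [hB']
    have h0 := productConst_pos d s
    have : B / productConst d s * (2 * (d / B) * ((d : ℝ) + 1) ^ s)
        = (2 * d * ((d : ℝ) + 1) ^ s) / productConst d s := by
      field_simp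
    rw [this, div_le_one h0, productConst]
    gcongr
    linarith
  unfold gevreyFactor
  rw [← hn, div_mul_eq_mul_div, div_le_iff₀ (by positivity)]
  calc A ^ n * ‖pderiv β (φ * ψ) x‖
      ≤ A ^ n * (C * D * (2 * (d / B)) ^ n *
          ((((d : ℝ) + 1) ^ s) ^ n * ((∏ j, (β j).factorial : ℕ) : ℝ) ^ s)) := by
        refine mul_le_mul_of_nonneg_left (e1.trans ?_) (by positivity)
        gcongr
    _ = (A * (2 * (d / B) * ((d : ℝ) + 1) ^ s)) ^ n * (C * D * ((∏ j, (β j).factorial : ℕ) : ℝ) ^ s) := by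
        rw [mul_pow A, mul_pow _ (((d : ℝ) + 1) ^ s)]
        ring
    _ ≤ 1 * (C * D * ((∏ j, (β j).factorial : ℕ) : ℝ) ^ s) := by
        gcongr
        exact pow_le_one₀ (by positivity) e3
    _ = _ := one_mul _

theorem gevreyNorm_mul_le {s A : ℝ} (hs : 0 ≤ s) (hA : 0 < A) {K : Set (Rd d)}
    {φ ψ : Rd d → ℂ} (hφ : ContDiff ℝ (⊤ : ℕ∞) φ) (hψ : ContDiff ℝ (⊤ : ℕ∞) ψ)
    (h1 : gevreyNorm s (productConst d s * A) K φ < ⊤)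
    (h2 : gevreyNorm s (productConst d s * A) K ψ < ⊤) :
    gevreyNorm s A K (φ * ψ) ≤
      gevreyNorm s (productConst d s * A) K φ * gevreyNorm s (productConst d s * A) K ψ := by
  rw [← ENNReal.ofReal_toReal h1.ne, ← ENNReal.ofReal_toReal h2.ne,
    ← ENNReal.ofReal_mul ENNReal.toReal_nonneg,
    gevreyNorm_le_ofReal_iff (mul_nonneg ENNReal.toReal_nonneg ENNReal.toReal_nonneg)]
  intro β x hx
  refine gevrey_mul_le hs hA ENNReal.toReal_nonneg ENNReal.toReal_nonneg hφ hψ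
    (fun γ => ?_) (fun γ => ?_) β
  · exact (gevreyNorm_le_ofReal_iff ENNReal.toReal_nonneg).1 (ENNReal.ofReal_toReal h1.ne).ge γ x hx
  · exact (gevreyNorm_le_ofReal_iff ENNReal.toReal_nonneg).1 (ENNReal.ofReal_toReal h2.ne).ge γ x hx

end Norms

/-! ### Test functions and ultradistributions of Beurling type -/

/-- The space `𝓔^{(s)}(ℝ^d)`: smooth functions with `‖φ‖_{s,A,K} < ∞` for all compact `K` and all
`A > 0`. -/
noncomputable def smoothSpace (d : ℕ) (s : ℝ) : Submodule ℂ (Rd d → ℂ) where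
  carrier := {φ | ContDiff ℝ (⊤ : ℕ∞) φ ∧
    ∀ K : Set (Rd d), IsCompact K → ∀ A : ℝ, 0 < A → gevreyNorm s A K φ < ⊤}
  add_mem' := fun {_ _} h1 h2 => ⟨h1.1.add h2.1, fun K hK A hA =>
    gevreyNorm_add_lt_top hA h1.1 h2.1 (h1.2 K hK A hA) (h2.2 K hK A hA)⟩
  zero_mem' := ⟨contDiff_const, fun K _ A _ => by rw [gevreyNorm_zero]; exact ENNReal.zero_lt_top⟩
  smul_mem' := fun c _ h => ⟨h.1.const_smul c, fun K hK A hA =>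
    gevreyNorm_smul_lt_top h.1 c (h.2 K hK A hA)⟩

/-- The space `𝓓^{(s)}(X)`: smooth functions, supported in some compact `K ⊆ X`, with
`‖φ‖_{s,A,K} < ∞` for all `A > 0`. They are regarded as functions on `ℝ^d`, extended by `0`. -/
noncomputable def testSpace (d : ℕ) (s : ℝ) (X : Set (Rd d)) : Submodule ℂ (Rd d → ℂ) where
  carrier := {φ | ContDiff ℝ (⊤ : ℕ∞) φ ∧ ∃ K : Set (Rd d), IsCompact K ∧ K ⊆ X ∧ tsupport φ ⊆ K ∧
    ∀ A : ℝ, 0 < A → gevreyNorm s A K φ < ⊤}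
  add_mem' := by
    rintro φ ψ ⟨h1, K, hK, hKX, hφK, hφ⟩ ⟨h2, L, hL, hLX, hψL, hψ⟩
    refine ⟨h1.add h2, K ∪ L, hK.union hL, union_subset hKX hLX,
      (tsupport_add φ ψ).trans (union_subset_union hφK hψL), fun A hA => ?_⟩
    exact gevreyNorm_add_lt_top hA h1 h2
      ((gevreyNorm_le_of_tsupport_subset hφK).trans_lt (hφ A hA))
      ((gevreyNorm_le_of_tsupport_subset hψL).trans_lt (hψ A hA))
  zero_mem' := ⟨contDiff_const, ∅, isCompact_empty, empty_subset _, by simp [tsupport],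
    fun A _ => by rw [gevreyNorm_zero]; exact ENNReal.zero_lt_top⟩
  smul_mem' := by
    rintro c φ ⟨h1, K, hK, hKX, hφK, hφ⟩
    exact ⟨h1.const_smul c, K, hK, hKX,
      (closure_mono (Function.support_const_smul_subset c φ)).trans hφK,
      fun A hA => gevreyNorm_smul_lt_top h1 c (hφ A hA)⟩

theorem gevreyNorm_lt_top_of_mem_testSpace {d : ℕ} {s : ℝ} {X : Set (Rd d)} {φ : Rd d → ℂ}
    (h : φ ∈ testSpace d s X) (L : Set (Rd d)) {A : ℝ} (hA : 0 < A) :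
    gevreyNorm s A L φ < ⊤ := by
  obtain ⟨_, K, _, _, hφK, hφ⟩ := h
  exact (gevreyNorm_le_of_tsupport_subset hφK).trans_lt (hφ A hA)

theorem testSpace_le_smoothSpace (d : ℕ) (s : ℝ) (X : Set (Rd d)) :
    testSpace d s X ≤ smoothSpace d s := fun _ h =>
  ⟨h.1, fun K _ _ hA => gevreyNorm_lt_top_of_mem_testSpace h K hA⟩

theorem mul_mem_testSpace {d : ℕ} {s : ℝ} (hs : 0 ≤ s) {X Y : Set (Rd d)} (hXY : X ⊆ Y)
    {φ g : Rd d → ℂ} (hφ : φ ∈ testSpace d s X) (hg : g ∈ smoothSpace d s) :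
    φ * g ∈ testSpace d s Y := by
  obtain ⟨h1, K, hK, hKX, hφK, _⟩ := id hφ
  refine ⟨h1.mul hg.1, K, hK, hKX.trans hXY, (tsupport_mul_subset_left).trans hφK,
    fun A hA => ?_⟩
  have hB := mul_pos (productConst_pos d s) hA
  have a1 := gevreyNorm_lt_top_of_mem_testSpace hφ K hB
  have a2 := hg.2 K hK _ hB
  exact (gevreyNorm_mul_le hs hA h1 hg.1 a1 a2).trans_lt (ENNReal.mul_lt_top a1 a2)

/-- `(𝓓^{(s)})'(ℝ^d)`: ultradistributions of Beurling type. Continuity on the inductive limit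
`𝓓^{(s)}(ℝ^d)` means continuity on each of the Fréchet spaces of test functions supported in a
fixed compact set `K`, whose topology is given by the increasing norms `‖·‖_{s,A,K}`, `A > 0`. -/
structure Ultradistribution (d : ℕ) (s : ℝ) where
  /-- the underlying linear functional -/
  toLin : testSpace d s univ →ₗ[ℂ] ℂ
  cont : ∀ K : Set (Rd d), IsCompact K → ∃ (A : ℝ) (C : ℝ≥0), 0 < A ∧
    ∀ φ : testSpace d s univ, tsupport (φ : Rd d → ℂ) ⊆ K →
      ‖toLin φ‖ₑ ≤ C * gevreyNorm s A K (φ : Rd d → ℂ)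

/-- `(𝓔^{(s)})'(ℝ^d)`: ultradistributions of Beurling type with compact support. Continuity on the
projective limit `𝓔^{(s)}(ℝ^d)` means that the functional is bounded by a multiple of one of the
directed seminorms `‖·‖_{s,A,K}`. -/
structure CompactUltradistribution (d : ℕ) (s : ℝ) where
  /-- the underlying linear functional -/
  toLin : smoothSpace d s →ₗ[ℂ] ℂ
  cont : ∃ (K : Set (Rd d)) (A : ℝ) (C : ℝ≥0), IsCompact K ∧ 0 < A ∧
    ∀ g : smoothSpace d s, ‖toLin g‖ₑ ≤ C * gevreyNorm s A K (g : Rd d → ℂ)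

/-- The restriction map `(𝓔^{(s)})'(ℝ^d) → (𝓓^{(s)})'(ℝ^d)`. -/
noncomputable def CompactUltradistribution.restrict {d : ℕ} {s : ℝ}
    (u : CompactUltradistribution d s) : Ultradistribution d s where
  toLin := u.toLin ∘ₗ Submodule.inclusion (testSpace_le_smoothSpace d s univ)
  cont := by
    intro L _
    obtain ⟨K, A, C, _, hA, hu⟩ := u.cont
    refine ⟨A, C, hA, fun φ hφ => (hu _).trans ?_⟩
    gcongr
    exact gevreyNorm_le_of_tsupport_subset hφ

/-! ### The exponentials `x ↦ e^{-i⟨x,ξ⟩}` -/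

theorem iteratedDeriv_expI (n : ℕ) :
    iteratedDeriv n (fun t : ℝ => Complex.exp (-(Complex.I * (t : ℂ)))) =
      fun t : ℝ => (-Complex.I) ^ n * Complex.exp (-(Complex.I * (t : ℂ))) := by
  induction n with
  | zero => simp
  | succ n ih =>
    rw [iteratedDeriv_succ, ih]
    funext t
    have h : HasDerivAt (fun t : ℝ => Complex.exp (-(Complex.I * (t : ℂ))))
        (Complex.exp (-(Complex.I * (t : ℂ))) * (-(Complex.I * 1))) t :=
      (((Complex.ofRealCLM.hasDerivAt (x := t)).const_mul Complex.I).neg).cexp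
    rw [(h.const_mul _).deriv]
    ring

theorem contDiff_expI : ContDiff ℝ (⊤ : ℕ∞) (fun t : ℝ => Complex.exp (-(Complex.I * (t : ℂ)))) :=
  ((contDiff_const.mul Complex.ofRealCLM.contDiff).neg).cexp

/-- The function `x ↦ e^{-i⟨x,ξ⟩}`. -/
noncomputable def expFun {d : ℕ} (ξ : Rd d) (x : Rd d) : ℂ :=
  Complex.exp (-(Complex.I * ((inner ℝ x ξ : ℝ) : ℂ)))

theorem contDiff_expFun {d : ℕ} (ξ : Rd d) : ContDiff ℝ (⊤ : ℕ∞) (expFun ξ) :=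
  contDiff_expI.comp (contDiff_id.inner ℝ contDiff_const)

theorem norm_iteratedFDeriv_expFun {d : ℕ} (ξ x : Rd d) (n : ℕ) :
    ‖iteratedFDeriv ℝ n (expFun ξ) x‖ ≤ ‖ξ‖ ^ n := by
  have he : expFun ξ = (fun t : ℝ => Complex.exp (-(Complex.I * (t : ℂ)))) ∘ (innerSL ℝ ξ) := by
    funext y
    simp [expFun, real_inner_comm]
  rw [he, ContinuousLinearMap.iteratedFDeriv_comp_right (innerSL ℝ ξ) contDiff_expI x
    (i := n) (by exact_mod_cast le_top)]
  refine (ContinuousMultilinearMap.norm_compContinuousLinearMap_le _ _).trans ?_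
  rw [norm_iteratedFDeriv_eq_norm_iteratedDeriv, iteratedDeriv_expI]
  have : ‖Complex.exp (-(Complex.I * (((innerSL ℝ ξ) x : ℝ) : ℂ)))‖ = 1 := by
    rw [Complex.norm_exp]
    simp
  simp only [norm_mul, norm_pow, norm_neg, Complex.norm_I, one_pow, this, one_mul,
    Finset.prod_const, Finset.card_univ, Fintype.card_fin, innerSL_apply_norm, le_refl]

theorem expFun_mem_smoothSpace {d : ℕ} {s : ℝ} (hs : 1 ≤ s) (ξ : Rd d) :
    expFun ξ ∈ smoothSpace d s := by
  refine ⟨contDiff_expFun ξ, fun K _ A hA => gevreyNorm_lt_top_iff.2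
    ⟨Real.exp (A * d * ‖ξ‖), (Real.exp_pos _).le, fun β x _ => ?_⟩⟩
  have hn := (norm_pderiv_le β (expFun ξ) x).trans (norm_iteratedFDeriv_expFun ξ x _)
  have hP : (1 : ℝ) ≤ ((∏ j, (β j).factorial : ℕ) : ℝ) := by
    exact_mod_cast Finset.prod_pos fun j _ => Nat.factorial_pos _
  have hPs : ((∏ j, (β j).factorial : ℕ) : ℝ) ≤ ((∏ j, (β j).factorial : ℕ) : ℝ) ^ s :=
    Real.self_le_rpow_of_one_le hP hs
  have hf : (((∑ j, β j).factorial : ℕ) : ℝ) ≤ (d : ℝ) ^ (∑ j, β j) * ((∏ j, (β j).factorial : ℕ) : ℝ) := by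
    exact_mod_cast factorial_sum_le β
  have hE := Real.pow_div_factorial_le_exp (A * d * ‖ξ‖) (by positivity) (∑ j, β j)
  have hf0 : (0 : ℝ) < (((∑ j, β j).factorial : ℕ) : ℝ) := by exact_mod_cast Nat.factorial_pos _
  set n := ∑ j, β j with hn'
  have hd : 0 < (d : ℝ) ^ n := by
    by_contra hd
    nlinarith
  unfold gevreyFactor
  rw [← hn']
  calc A ^ n / ((∏ j, (β j).factorial : ℕ) : ℝ) ^ s * ‖pderiv β (expFun ξ) x‖
      ≤ A ^ n / ((n.factorial : ℝ) / (d : ℝ) ^ n) * ‖ξ‖ ^ n := by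
        gcongr
        rw [div_le_iff₀ hd, mul_comm]
        exact hf.trans (by gcongr)
    _ = (A * d * ‖ξ‖) ^ n / (n.factorial : ℝ) := by
        field_simp
        ring
    _ ≤ _ := hE

section Localization

variable {d : ℕ} {s : ℝ} [hs : Fact (1 < s)]

/-- Multiplication by `φ ∈ 𝓓^{(s)}(X)`, as a map `𝓔^{(s)}(ℝ^d) → 𝓓^{(s)}(ℝ^d)`. -/
noncomputable def mulLin {X : Set (Rd d)} (φ : testSpace d s X) :
    smoothSpace d s →ₗ[ℂ] testSpace d s univ where
  toFun g := ⟨(φ : Rd d → ℂ) * (g : Rd d → ℂ),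
    mul_mem_testSpace (zero_le_one.trans hs.out.le) (subset_univ X) φ.2 g.2⟩
  map_add' _ _ := Subtype.ext (mul_add _ _ _)
  map_smul' _ _ := Subtype.ext (mul_smul_comm _ _ _)

/-- The product `φ f`, for `φ ∈ 𝓓^{(s)}(X)` and `f ∈ (𝓓^{(s)})'(ℝ^d)`, as an ultradistribution with
compact support: `⟨φ f, g⟩ = ⟨f, φ g⟩` for `g ∈ 𝓔^{(s)}(ℝ^d)`. -/
noncomputable def localize {X : Set (Rd d)} (φ : testSpace d s X) (f : Ultradistribution d s) :
    CompactUltradistribution d s where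
  toLin := f.toLin ∘ₗ mulLin φ
  cont := by
    obtain ⟨h1, K, hK, hKX, hφK, _⟩ := id φ.2
    obtain ⟨A, C, hA, hf⟩ := f.cont K hK
    have hB := mul_pos (productConst_pos d s) hA
    have a1 := gevreyNorm_lt_top_of_mem_testSpace φ.2 K hB
    refine ⟨K, productConst d s * A,
      C * (gevreyNorm s (productConst d s * A) K (φ : Rd d → ℂ)).toNNReal, hK, hB, fun g => ?_⟩
    refine (hf (mulLin φ g) ((tsupport_mul_subset_left).trans hφK)).trans ?_
    rw [ENNReal.coe_mul, ENNReal.coe_toNNReal a1.ne, mul_assoc]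
    gcongr
    exact gevreyNorm_mul_le (zero_le_one.trans hs.out.le) hA h1 g.2.1 a1 (g.2.2 K hK _ hB)

/-- The product `φ f` as an element of `(𝓓^{(s)})'(ℝ^d)`. -/
noncomputable def mulUltra {X : Set (Rd d)} (φ : testSpace d s X) (f : Ultradistribution d s) :
    Ultradistribution d s :=
  (localize φ f).restrict

/-! ### Fourier transform and wave-front sets -/

/-- The Fourier transform of an ultradistribution with compact support, which is the function
`ξ ↦ (2π)^{-d/2} ⟨u, e^{-i⟨·,ξ⟩}⟩`. -/
noncomputable def ultraFourier (u : CompactUltradistribution d s) (ξ : Rd d) : ℂ :=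
  (((2 * Real.pi) ^ (-(d : ℝ) / 2) : ℝ) : ℂ) *
    u.toLin ⟨expFun ξ, expFun_mem_smoothSpace hs.out.le ξ⟩

end Localization

/-- Moderate weights on a Euclidean space `V`: `ω` belongs to the class `𝓜_{s}(V)` if it is a
non-negative (measurable) function which is `v`-moderate for some submultiplicative non-negative
function `v` with `v ≤ C e^{k|·|^{1/s}}` for some `C, k > 0`. -/
def IsModerateWeight {V : Type*} [NormedAddCommGroup V] [MeasurableSpace V] (s : ℝ)
    (ω : V → ℝ) : Prop :=
  Measurable ω ∧ (∀ z, 0 ≤ ω z) ∧ ∃ v : V → ℝ,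
    (∀ z, 0 ≤ v z) ∧
    (∀ z w, v (z + w) ≤ v z * v w) ∧
    (∃ C k : ℝ, 0 < C ∧ 0 < k ∧ ∀ z, v z ≤ C * Real.exp (k * ‖z‖ ^ (1 / s))) ∧
    ∃ c : ℝ, 0 < c ∧ ∀ z w, ω (z + w) ≤ c * (v z * ω w)

/-- The space `ℝ^{2d}`, as the product `ℝ^d × ℝ^d` with the Euclidean norm. -/
abbrev R2d (d : ℕ) : Type := WithLp 2 (Rd d × Rd d)

/-- The point `(x, ξ)` of `ℝ^{2d}`. -/
abbrev pt {d : ℕ} (x ξ : Rd d) : R2d d := WithLp.toLp 2 (x, ξ)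

/-- Open cones in `ℝ^d ∖ 0`. -/
def IsOpenCone {d : ℕ} (Γ : Set (Rd d)) : Prop :=
  IsOpen Γ ∧ (0 : Rd d) ∉ Γ ∧ ∀ ξ ∈ Γ, ∀ t : ℝ, 0 < t → t • ξ ∈ Γ

section WaveFront

variable {d : ℕ} {s : ℝ} [Fact (1 < s)]

/-- The seminorm `|u|_{𝓕L^{q,Γ}_{(ω),x}}`: the `L^q(Γ)`-norm of `ξ ↦ û(ξ) ω(x,ξ)`, possibly `∞`. -/
noncomputable def coneSeminorm (q : ℝ≥0∞) (ω : R2d d → ℝ) (x : Rd d) (Γ : Set (Rd d))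
    (u : CompactUltradistribution d s) : ℝ≥0∞ :=
  eLpNorm (fun ξ => ultraFourier u ξ * ((ω (pt x ξ) : ℝ) : ℂ)) q (volume.restrict Γ)

/-- `Θ_𝓑(u)` for `𝓑 = 𝓕L^q_{(ω)}`: the `ξ ≠ 0` having an open conical neighbourhood on which the
seminorm of `u` is finite. The reference point `x` is an explicit parameter. -/
def regularDirections (q : ℝ≥0∞) (ω : R2d d → ℝ) (x : Rd d) (u : CompactUltradistribution d s) :
    Set (Rd d) :=
  {ξ | ξ ≠ 0 ∧ ∃ Γ : Set (Rd d), IsOpenCone Γ ∧ ξ ∈ Γ ∧ coneSeminorm q ω x Γ u < ⊤}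

/-- `Σ_𝓑(u)`, the complement of `Θ_𝓑(u)` in `ℝ^d ∖ 0`. -/
def singularDirections (q : ℝ≥0∞) (ω : R2d d → ℝ) (x : Rd d) (u : CompactUltradistribution d s) :
    Set (Rd d) :=
  {ξ | ξ ≠ 0 ∧ ξ ∉ regularDirections q ω x u}

/-- The wave-front set of `f ∈ (𝓓^{(s)})'(ℝ^d)` with respect to `𝓕L^q_{(ω)}` over the open set `X`:
all `(x₀, ξ₀) ∈ X × (ℝ^d ∖ 0)` such that `ξ₀ ∈ Σ_𝓑(φ f)` for every `φ ∈ 𝓓^{(s)}(X)` with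
`φ(x₀) ≠ 0`. -/
def waveFrontSet (q : ℝ≥0∞) (ω : R2d d → ℝ) (x : Rd d) (X : Set (Rd d))
    (f : Ultradistribution d s) : Set (Rd d × Rd d) :=
  {p | p.1 ∈ X ∧ p.2 ≠ 0 ∧ ∀ φ : testSpace d s X, (φ : Rd d → ℂ) p.1 ≠ 0 →
    p.2 ∈ singularDirections q ω x (localize φ f)}

end WaveFront

end UltraWF

open UltraWF

open UltraWF
open scoped FourierTransform

namespace UltraWF

/-! ### Numerical inequalities for Gevrey growth -/

/-! The core is a microlocal estimate (`regularDirections_subset_of_eq_mul`): if `v = η u` with `η`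
a Gevrey test function, then every direction regular for `u` with respect to `(r, ϑ)` is regular for
`v` with respect to `(q, ω)`. On the Fourier side, multiplication by `η` is convolution with a
kernel bounded by `C e^{-N|·|^{1/s}}` for every `N`; this strength of decay is what the Beurling
condition gives. Moderate weights, and `û` itself by continuity of `u`, grow at most like
`e^{k|·|^{1/s}}`, so a large `N` absorbs them.

Let `û ϑ` be in `L^r` on a cone `Γ`, and let `ξ` lie in a smaller cone `Γ'`. In the convolution
integral the part `τ ∈ Γ` is controlled by moving the weight from `ξ` to `τ`. For `τ ∉ Γ` the
distance `|ξ - τ|` dominates both `|ξ|` and `|τ|`, so the kernel beats the growth of `û` and `ω` and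
still leaves a factor decaying in `τ`. Hence `|v̂ ω|` on `Γ'` is at most a multiple of `G * F` with
`G` bounded and integrable and `F ∈ L^r`, and such a convolution lies in `L^q` for every `q ≥ r`
(`eLpNorm_convolution_lt_top`). Moderateness also absorbs the change of reference point.

To justify the convolution formula, a compactly supported ultradistribution is extended by
Hahn–Banach to a bounded functional on a Banach space of jets (`exists_eq_comp_jet`). Fourier
inversion of a test function holds there as a Bochner integral, through which the functional passes
(`apply_eq_integral`).

For wave-front sets, use `ψ(φf) = φ(ψf)` for the first inclusion and `ψ²f = ψ(ψf)` for the second.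
-/

theorem pow_div_factorial_rpow_le_exp {s t : ℝ} (hs : 0 < s) (ht : 0 ≤ t) (n : ℕ) :
    t ^ n / (n.factorial : ℝ) ^ s ≤ Real.exp (s * t ^ (1 / s)) := by
  -- One term of the exponential series at `t^{1/s}`, raised to the power `s`.
  have h := Real.pow_div_factorial_le_exp (t ^ (1 / s)) (by positivity) n
  have h2 := Real.rpow_le_rpow (by positivity) h hs.le
  rw [Real.div_rpow (by positivity) (by positivity), ← Real.exp_mul, ← Real.rpow_natCast,
    ← Real.rpow_mul ht, ← Real.rpow_mul ht] at h2
  have e : 1 / s * (n : ℝ) * s = n := by field_simp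
  rw [e, Real.rpow_natCast, mul_comm (t ^ (1 / s))] at h2
  exact h2

/-- Take `s`-th roots, divide by `2^n n!` and sum over `n`: the left side becomes an exponential
series, the right side a geometric one. Raising to the power `s` again gives the decay. -/
theorem le_exp_neg_of_forall_pow_mul_le {s t a C : ℝ} (hs : 0 < s) (ht : 0 ≤ t) (ha : 0 ≤ a)
    (h : ∀ n : ℕ, t ^ n * a ≤ C * (n.factorial : ℝ) ^ s) :
    a ≤ 2 ^ s * C * Real.exp (-(s / 2 * t ^ (1 / s))) := by
  have hC : 0 ≤ C := ha.trans (by simpa using h 0)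
  have key : ∀ n : ℕ, (t ^ (1 / s) / 2) ^ n / (n.factorial : ℝ) * a ^ (1 / s) ≤
      C ^ (1 / s) * (1 / 2) ^ n := by
    intro n
    have h1 := Real.rpow_le_rpow (by positivity) (h n) (z := 1 / s) (by positivity)
    rw [Real.mul_rpow (by positivity) ha, Real.mul_rpow hC (by positivity),
      ← Real.rpow_mul (by positivity), mul_one_div_cancel hs.ne', Real.rpow_one,
      ← Real.rpow_natCast, ← Real.rpow_mul ht, mul_comm (n : ℝ), Real.rpow_mul ht,
      Real.rpow_natCast] at h1
    have hn : (0 : ℝ) < n.factorial := by exact_mod_cast n.factorial_pos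
    rw [div_pow, div_div, div_mul_eq_mul_div, div_le_iff₀ (by positivity)]
    calc _ ≤ C ^ (1 / s) * (n.factorial : ℝ) := h1
      _ = _ := by rw [one_div_pow]; field_simp
  have hs1 : HasSum (fun n : ℕ => (t ^ (1 / s) / 2) ^ n / (n.factorial : ℝ) * a ^ (1 / s))
      (Real.exp (t ^ (1 / s) / 2) * a ^ (1 / s)) := by
    rw [Real.exp_eq_exp_ℝ]
    exact (NormedSpace.expSeries_div_hasSum_exp (t ^ (1 / s) / 2)).mul_right _
  have hs2 := hasSum_geometric_two.mul_left (C ^ (1 / s))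
  have h3 := Real.rpow_le_rpow (by positivity) (hasSum_le key hs1 hs2) hs.le
  rw [Real.mul_rpow (by positivity) (by positivity), Real.mul_rpow (by positivity) (by positivity),
    ← Real.rpow_mul ha, ← Real.rpow_mul hC, one_div_mul_cancel hs.ne', Real.rpow_one,
    Real.rpow_one, ← Real.exp_mul] at h3
  rw [Real.exp_neg, ← div_eq_mul_inv, le_div_iff₀ (Real.exp_pos _)]
  calc _ = Real.exp (t ^ (1 / s) / 2 * s) * a := by rw [mul_comm]; congr 2; ring
    _ ≤ _ := h3.trans_eq (mul_comm _ _)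

/-! ### Decay of the Fourier transform of a test function -/

variable {d : ℕ}

theorem hasCompactSupport_of_mem_testSpace {s : ℝ} {X : Set (Rd d)} {h : Rd d → ℂ}
    (hh : h ∈ testSpace d s X) : HasCompactSupport h := by
  obtain ⟨_, K, hK, _, hKs, _⟩ := hh
  exact hK.of_isClosed_subset (isClosed_tsupport _) hKs

theorem integrable_iteratedFDeriv_of_mem_testSpace {s : ℝ} {X : Set (Rd d)} {h : Rd d → ℂ}
    (hh : h ∈ testSpace d s X) (n : ℕ) : Integrable (iteratedFDeriv ℝ n h) :=
  (hh.1.continuous_iteratedFDeriv (by exact_mod_cast le_top)).integrable_of_hasCompactSupport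
    ((hasCompactSupport_of_mem_testSpace hh).iteratedFDeriv n)

theorem integral_norm_iteratedFDeriv_le {s : ℝ} (hs : 0 ≤ s) {X : Set (Rd d)} {h : Rd d → ℂ}
    (hh : h ∈ testSpace d s X) {ε : ℝ} (hε : 0 < ε) : ∃ C : ℝ, 0 ≤ C ∧ ∀ n : ℕ,
      ∫ x, ‖iteratedFDeriv ℝ n h x‖ ≤ C * ε ^ n * (n.factorial : ℝ) ^ s := by
  obtain ⟨C, hC, hb⟩ := gevreyNorm_lt_top_iff.1
    -- The Beurling condition permits any `A`, hence any `ε`. The numerator is `d + 1`, not `d`, so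
    -- that `A > 0` also when `d = 0`.
    (gevreyNorm_lt_top_of_mem_testSpace hh univ (A := (d + 1) / ε) (by positivity))
  have hsupp := hasCompactSupport_of_mem_testSpace hh
  refine ⟨C * volume.real (tsupport h), by positivity, fun n => ?_⟩
  have hbd : ∀ x, ‖iteratedFDeriv ℝ n h x‖ ≤ C * ε ^ n * (n.factorial : ℝ) ^ s := fun x => by
    refine (norm_iteratedFDeriv_le_of_gevrey hs (by positivity) hC hh.1
      (fun β => hb β x (mem_univ x)) n).trans ?_
    have : (d : ℝ) / ((d + 1) / ε) ≤ ε := by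
      rw [div_div_eq_mul_div, div_le_iff₀ (by positivity)]
      nlinarith
    gcongr
  rw [← setIntegral_eq_integral_of_forall_compl_eq_zero (s := tsupport h)]
  · calc _ ≤ ∫ x in tsupport h, C * ε ^ n * (n.factorial : ℝ) ^ s := by
          refine setIntegral_mono ((integrable_iteratedFDeriv_of_mem_testSpace hh n).norm.integrableOn)
            (integrableOn_const hsupp.measure_lt_top.ne) hbd
      _ = _ := by
          rw [setIntegral_const, smul_eq_mul]
          ring
  · intro x hx
    rw [norm_eq_zero]
    by_contra hne
    exact hx (support_iteratedFDeriv_subset n hne)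

theorem norm_fourier_le_integral_norm {E : Type*} [NormedAddCommGroup E] [NormedSpace ℂ E]
    (h : Rd d → E) (w : Rd d) : ‖𝓕 h w‖ ≤ ∫ x, ‖h x‖ :=
  VectorFourier.norm_fourierIntegral_le_integral_norm Real.fourierChar volume
    (innerₗ (Rd d)) h w

/-- The transform of the `n`-th derivative at `w`, applied to `(w, …, w)`, has norm `(2π)^n ‖w‖^{2n}
‖𝓕 h w‖`. The operator norm costs only `‖w‖^n`, which is divided out; this is why `w = 0` is treated
separately. -/
theorem pow_mul_norm_fourier_le {h : Rd d → ℂ} (hh : ContDiff ℝ (⊤ : ℕ∞) h)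
    (hi : ∀ n : ℕ, Integrable (iteratedFDeriv ℝ n h)) (n : ℕ) (w : Rd d) :
    (2 * Real.pi * ‖w‖) ^ n * ‖𝓕 h w‖ ≤ ∫ x, ‖iteratedFDeriv ℝ n h x‖ := by
  rcases eq_or_ne w 0 with rfl | hw
  · rcases Nat.eq_zero_or_pos n with rfl | hn
    · simpa using norm_fourier_le_integral_norm h (0 : Rd d)
    · rw [norm_zero, mul_zero, zero_pow hn.ne', zero_mul]
      positivity
  have h1 := congrFun (Real.fourier_iteratedFDeriv (N := ⊤) hh (fun n _ => hi n) (n := n) le_top) w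
  have h2 := norm_fourier_le_integral_norm (iteratedFDeriv ℝ n h) w
  rw [h1] at h2
  have h3 := (VectorFourier.fourierPowSMulRight (-innerSL ℝ) (𝓕 h) w n).le_opNorm (fun _ => w)
  have hw' : 0 < ‖w‖ ^ n := pow_pos (norm_pos_iff.2 hw) n
  refine le_of_mul_le_mul_right ?_ hw'
  calc _ = ‖VectorFourier.fourierPowSMulRight (-innerSL ℝ) (𝓕 h) w n (fun _ => w)‖ := by
        rw [VectorFourier.fourierPowSMulRight_apply]
        have hin : |(innerSL ℝ w) w| = ‖w‖ ^ 2 := by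
          rw [innerSL_apply_apply, real_inner_self_eq_norm_sq, abs_pow, abs_norm]
        simp only [FunLike.coe_neg, Pi.neg_apply, Finset.prod_const, Finset.card_univ,
          Fintype.card_fin, norm_smul, norm_pow, norm_neg, norm_mul, Complex.norm_I,
          Complex.norm_real, Real.norm_eq_abs, hin, abs_of_nonneg Real.pi_nonneg,
          Complex.norm_ofNat]
        ring
    _ ≤ _ := by
        simp only [Finset.prod_const, Finset.card_univ, Fintype.card_fin] at h3
        exact h3.trans (by gcongr)

/-- The Fourier transform of a Gevrey test function of Beurling type decays faster than
`e^{-N|·|^{1/s}}` for every `N`. -/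
theorem norm_fourier_le_exp {s : ℝ} (hs : 0 < s) {X : Set (Rd d)} {h : Rd d → ℂ}
    (hh : h ∈ testSpace d s X) {N : ℝ} (hN : 0 < N) : ∃ C : ℝ, 0 ≤ C ∧ ∀ w : Rd d,
      ‖𝓕 h w‖ ≤ C * Real.exp (-(N * (2 * Real.pi * ‖w‖) ^ (1 / s))) := by
  -- Chosen so that `(s/2) (t/ε)^{1/s} = N t^{1/s}`.
  set ε : ℝ := (s / (2 * N)) ^ s with hεd
  have hε : 0 < ε := by positivity
  obtain ⟨C, hC, hb⟩ := integral_norm_iteratedFDeriv_le hs.le hh hε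
  refine ⟨2 ^ s * C, by positivity, fun w => ?_⟩
  have hpi := Real.pi_pos
  have := le_exp_neg_of_forall_pow_mul_le (t := 2 * Real.pi * ‖w‖ / ε) (a := ‖𝓕 h w‖) (C := C) hs
    (by positivity) (norm_nonneg _) (fun n => ?_)
  · refine this.trans_eq ?_
    congr 3
    rw [Real.div_rpow (by positivity) hε.le, hεd, ← Real.rpow_mul (by positivity),
      mul_one_div_cancel hs.ne', Real.rpow_one]
    field_simp
  · have h1 := (pow_mul_norm_fourier_le hh.1
      (integrable_iteratedFDeriv_of_mem_testSpace hh) n w).trans (hb n)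
    rw [div_pow, div_mul_eq_mul_div, div_le_iff₀ (by positivity)]
    exact h1.trans_eq (by ring)

theorem norm_fourierInv_le_exp {s : ℝ} (hs : 0 < s) {X : Set (Rd d)} {h : Rd d → ℂ}
    (hh : h ∈ testSpace d s X) {N : ℝ} (hN : 0 < N) : ∃ C : ℝ, 0 ≤ C ∧ ∀ w : Rd d,
      ‖𝓕⁻ h w‖ ≤ C * Real.exp (-(N * (2 * Real.pi * ‖w‖) ^ (1 / s))) := by
  obtain ⟨C, hC, hb⟩ := norm_fourier_le_exp hs hh hN
  refine ⟨C, hC, fun w => ?_⟩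
  rw [Real.fourierInv_eq_fourier_neg, ← norm_neg w]
  exact hb (-w)

/-! ### Integrability of exponentials -/

theorem exists_exp_neg_le_rpow {s ε : ℝ} (hs : 0 < s) (hε : 0 < ε) (r : ℝ) :
    ∃ C : ℝ, 0 ≤ C ∧ ∀ t : ℝ, 0 ≤ t → Real.exp (-(ε * t ^ (1 / s))) ≤ C * (1 + t) ^ (-r) := by
  -- The product tends to `0` at infinity and is continuous on each compact interval `[0, T]`, hence
  -- bounded on `t ≥ 0`.
  have h : Filter.Tendsto (fun t : ℝ => (1 + t) ^ r * Real.exp (-(ε * t ^ (1 / s))))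
      Filter.atTop (nhds 0) := by
    have h1 : Filter.Tendsto (fun t : ℝ => (t ^ (1 / s)) ^ (s * r) *
        Real.exp (-ε * t ^ (1 / s))) Filter.atTop (nhds 0) :=
      (tendsto_rpow_mul_exp_neg_mul_atTop_nhds_zero (s * r) ε hε).comp
        (tendsto_rpow_atTop (by positivity))
    have h2 : Filter.Tendsto (fun t : ℝ => ((1 + t) / t) ^ r) Filter.atTop (nhds ((0 + 1) ^ r)) := by
      refine Filter.Tendsto.rpow_const ?_ (Or.inl (by norm_num))
      refine (tendsto_inv_atTop_zero.add_const 1).congr' ?_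
      filter_upwards [Filter.eventually_gt_atTop 0] with t ht
      field_simp
    have h3 := h2.mul h1
    rw [mul_zero] at h3
    refine h3.congr' ?_
    filter_upwards [Filter.eventually_gt_atTop 0] with t ht
    rw [← Real.rpow_mul ht.le, ← mul_assoc (1 / s), one_div_mul_cancel hs.ne', one_mul,
      Real.div_rpow (by positivity) ht.le, neg_mul, ← mul_assoc, div_mul_cancel₀]
    exact (Real.rpow_pos_of_pos ht r).ne'
  obtain ⟨T, hT⟩ := Filter.eventually_atTop.1 (h.eventually (gt_mem_nhds one_pos))
  have hc : ContinuousOn (fun t : ℝ => (1 + t) ^ r * Real.exp (-(ε * t ^ (1 / s)))) (Icc 0 T) := by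
    refine ContinuousOn.mul ?_ ?_
    · refine ContinuousOn.rpow_const (by fun_prop) fun t ht => Or.inl ?_
      have := ht.1
      positivity
    · refine Real.continuous_exp.comp_continuousOn ?_
      refine (continuousOn_const.mul ?_).neg
      exact continuousOn_id.rpow_const fun t _ => Or.inr (by positivity)
  obtain ⟨M, hM⟩ := isCompact_Icc.bddAbove_image hc
  refine ⟨max 1 M, by positivity, fun t ht => ?_⟩
  rw [Real.rpow_neg (by positivity), ← div_eq_mul_inv, le_div_iff₀ (by positivity), mul_comm]
  rcases le_total t T with htT | htT
  · exact (hM (mem_image_of_mem _ ⟨ht, htT⟩)).trans (le_max_right _ _)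
  · exact (hT t htT).le.trans (le_max_left _ _)

theorem integrable_exp_neg_norm_rpow {s ε : ℝ} (hs : 0 < s) (hε : 0 < ε) :
    Integrable (fun x : Rd d => Real.exp (-(ε * ‖x‖ ^ (1 / s)))) := by
  obtain ⟨C, hC, hb⟩ := exists_exp_neg_le_rpow hs hε ((d : ℝ) + 1)
  have h1 : Integrable (fun x : Rd d => C * (1 + ‖x‖) ^ (-((d : ℝ) + 1))) :=
    (integrable_one_add_norm (by simp)).const_mul C
  refine h1.mono' ?_ (Filter.Eventually.of_forall fun x => ?_)
  · refine Continuous.aestronglyMeasurable ?_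
    refine Real.continuous_exp.comp (continuous_const.mul ?_).neg
    exact continuous_norm.rpow_const fun _ => Or.inr (by positivity)
  · rw [Real.norm_of_nonneg (Real.exp_pos _).le]
    exact hb _ (norm_nonneg x)

end UltraWF

namespace UltraWF

variable {d : ℕ}

/-! ### Derivatives of the exponentials -/

theorem iteratedFDeriv_expFun_apply (ξ x : Rd d) (n : ℕ) (v : Fin n → Rd d) :
    iteratedFDeriv ℝ n (expFun ξ) x v =
      (∏ i, (-Complex.I * ((inner ℝ ξ (v i) : ℝ) : ℂ))) * expFun ξ x := by
  have he : expFun ξ = (fun t : ℝ => Complex.exp (-(Complex.I * (t : ℂ)))) ∘ (innerSL ℝ ξ) := by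
    funext y
    simp [expFun, real_inner_comm]
  rw [he, ContinuousLinearMap.iteratedFDeriv_comp_right (innerSL ℝ ξ) contDiff_expI x
    (i := n) (by exact_mod_cast le_top), ContinuousMultilinearMap.compContinuousLinearMap_apply,
    iteratedFDeriv_apply_eq_iteratedDeriv_mul_prod, iteratedDeriv_expI, Finset.prod_mul_distrib]
  simp only [innerSL_apply_apply, Finset.prod_const, Finset.card_univ, Fintype.card_fin,
    Complex.real_smul, Complex.ofReal_prod, Function.comp_apply]
  ring

theorem norm_expFun (ξ x : Rd d) : ‖expFun ξ x‖ = 1 := by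
  rw [expFun, Complex.norm_exp]
  simp

theorem expFun_add (ξ τ x : Rd d) : expFun (ξ + τ) x = expFun ξ x * expFun τ x := by
  rw [expFun, expFun, expFun, ← Complex.exp_add, inner_add_right]
  congr 1
  push_cast
  ring

theorem norm_expFun_sub_le (ξ τ x : Rd d) : ‖expFun ξ x - expFun τ x‖ ≤ ‖x‖ * ‖ξ - τ‖ := by
  have h : expFun ξ x - expFun τ x = expFun τ x * (expFun (ξ - τ) x - 1) := by
    rw [mul_sub, ← expFun_add, add_sub_cancel, mul_one]
  rw [h, norm_mul, norm_expFun, one_mul, expFun]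
  have h2 := Real.norm_exp_I_mul_ofReal_sub_one_le (x := -inner ℝ x (ξ - τ))
  have e : -(Complex.I * ((inner ℝ x (ξ - τ) : ℝ) : ℂ)) =
      Complex.I * ((-inner ℝ x (ξ - τ) : ℝ) : ℂ) := by
    push_cast
    ring
  rw [e]
  refine h2.trans ?_
  rw [norm_neg]
  exact norm_inner_le_norm x (ξ - τ)

/-- Telescoping, one factor exchanged at a time. The condition `R ≥ 1` allows the missing power of
`R` to be restored. -/
theorem norm_prod_sub_prod_le {ι : Type*} (t : Finset ι) {a b : ι → ℂ} {R δ : ℝ} (hR : 1 ≤ R)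
    (hδ : 0 ≤ δ) (ha : ∀ i, ‖a i‖ ≤ R) (hb : ∀ i, ‖b i‖ ≤ R) (hab : ∀ i, ‖a i - b i‖ ≤ δ) :
    ‖∏ i ∈ t, a i - ∏ i ∈ t, b i‖ ≤ t.card * R ^ t.card * δ := by
  classical
  induction t using Finset.induction_on with
  | empty => simp
  | insert i t hi ih =>
    rw [Finset.prod_insert hi, Finset.prod_insert hi, Finset.card_insert_of_notMem hi]
    have h1 : a i * ∏ j ∈ t, a j - b i * ∏ j ∈ t, b j =
        (a i - b i) * ∏ j ∈ t, a j + b i * (∏ j ∈ t, a j - ∏ j ∈ t, b j) := by ring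
    have h2 : ‖∏ j ∈ t, a j‖ ≤ R ^ t.card := by
      rw [norm_prod]
      exact (Finset.prod_le_prod (fun _ _ => norm_nonneg _) fun j _ => ha j).trans_eq (by simp)
    rw [h1]
    calc _ ≤ δ * R ^ t.card + R * (t.card * R ^ t.card * δ) := by
          refine (norm_add_le _ _).trans ?_
          rw [norm_mul, norm_mul]
          gcongr
          exacts [hab i, hb i]
      _ ≤ R * (δ * R ^ t.card) + R * (t.card * R ^ t.card * δ) :=
          add_le_add (le_mul_of_one_le_left (by positivity) hR) le_rfl
      _ = _ := by push_cast; ring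

theorem norm_pderiv_expFun_le (β : Fin d → ℕ) (ξ x : Rd d) :
    ‖pderiv β (expFun ξ) x‖ ≤ ‖ξ‖ ^ (∑ j, β j) :=
  (norm_pderiv_le β _ x).trans (norm_iteratedFDeriv_expFun ξ x _)

theorem norm_pderiv_expFun_sub_le (β : Fin d → ℕ) {ξ τ : Rd d} (x : Rd d) {R : ℝ} (hR : 1 ≤ R)
    (hξ : ‖ξ‖ ≤ R) (hτ : ‖τ‖ ≤ R) :
    ‖pderiv β (expFun ξ) x - pderiv β (expFun τ) x‖ ≤
      (2 * R) ^ (∑ j, β j) * ((1 + ‖x‖) * ‖ξ - τ‖) := by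
  unfold pderiv
  set n := ∑ j, β j
  rw [iteratedFDeriv_expFun_apply, iteratedFDeriv_expFun_apply]
  set v : Fin n → Rd d := fun i => EuclideanSpace.single (finSigmaFinEquiv.symm i).1 (1 : ℝ)
  have hv : ∀ (ζ : Rd d) (i : Fin n), ‖-Complex.I * ((inner ℝ ζ (v i) : ℝ) : ℂ)‖ ≤ ‖ζ‖ := by
    intro ζ i
    rw [norm_mul, norm_neg, Complex.norm_I, one_mul, Complex.norm_real]
    refine (norm_inner_le_norm ζ (v i)).trans ?_
    simp [v]
  have h1 := norm_prod_sub_prod_le (Finset.univ : Finset (Fin n))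
    (a := fun i => -Complex.I * ((inner ℝ ξ (v i) : ℝ) : ℂ))
    (b := fun i => -Complex.I * ((inner ℝ τ (v i) : ℝ) : ℂ)) hR (norm_nonneg (ξ - τ))
    (fun i => (hv ξ i).trans hξ) (fun i => (hv τ i).trans hτ) (fun i => by
      rw [← mul_sub, ← Complex.ofReal_sub, ← inner_sub_left]
      exact hv _ i)
  have h2 : ‖∏ i, (-Complex.I * ((inner ℝ τ (v i) : ℝ) : ℂ))‖ ≤ R ^ n := by
    rw [norm_prod]
    exact (Finset.prod_le_prod (fun _ _ => norm_nonneg _)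
      fun j _ => (hv τ j).trans hτ).trans_eq (by simp)
  rw [Finset.card_univ, Fintype.card_fin] at h1
  -- The number `n` of telescoping terms is absorbed into a geometric factor, so that the bound
  -- keeps the form `(2R)^n` that the Gevrey factor can control.
  have hn : (n : ℝ) ≤ 2 ^ n := by exact_mod_cast Nat.lt_two_pow_self.le
  have h3 : (1 : ℝ) ≤ 2 ^ n := one_le_pow₀ (by norm_num)
  generalize ∏ i, (-Complex.I * ((inner ℝ ξ (v i) : ℝ) : ℂ)) = a at *
  generalize ∏ i, (-Complex.I * ((inner ℝ τ (v i) : ℝ) : ℂ)) = b at *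
  have e : a * expFun ξ x - b * expFun τ x =
      (a - b) * expFun ξ x + b * (expFun ξ x - expFun τ x) := by ring
  rw [e]
  calc _ ≤ n * R ^ n * ‖ξ - τ‖ * 1 + R ^ n * (‖x‖ * ‖ξ - τ‖) := by
        refine (norm_add_le _ _).trans ?_
        rw [norm_mul, norm_mul, norm_expFun]
        gcongr
        exact norm_expFun_sub_le ξ τ x
    _ ≤ 2 ^ n * R ^ n * ‖ξ - τ‖ * 1 + 2 ^ n * R ^ n * (‖x‖ * ‖ξ - τ‖) := by
        gcongr
        exact le_mul_of_one_le_left (by positivity) h3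
    _ = _ := by rw [mul_pow]; ring

/-- The multinomial bound `|β|! ≤ d^{|β|} β!` reduces the claim to the one-variable inequality for
`t = A d^s R`. -/
theorem gevreyFactor_mul_pow_le {s A R : ℝ} (hs : 0 < s) (hA : 0 < A) (hR : 0 ≤ R)
    (β : Fin d → ℕ) : gevreyFactor s A β * R ^ (∑ j, β j) ≤
      Real.exp (s * (A * (d : ℝ) ^ s * R) ^ (1 / s)) := by
  refine le_trans ?_ (pow_div_factorial_rpow_le_exp hs (by positivity) (∑ j, β j))
  have h1 : ((∑ j, β j).factorial : ℝ) ^ s ≤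
      ((d : ℝ) ^ s) ^ (∑ j, β j) * ((∏ j, (β j).factorial : ℕ) : ℝ) ^ s := by
    rw [← Real.rpow_natCast, ← Real.rpow_mul (by positivity), mul_comm s, Real.rpow_mul
      (by positivity), Real.rpow_natCast, ← Real.mul_rpow (by positivity) (by positivity)]
    exact Real.rpow_le_rpow (by positivity) (by exact_mod_cast factorial_sum_le β) hs.le
  have hP : (0 : ℝ) < ((∏ j, (β j).factorial : ℕ) : ℝ) := by
    exact_mod_cast Finset.prod_pos fun j _ => Nat.factorial_pos _
  unfold gevreyFactor
  rw [div_mul_eq_mul_div, div_le_div_iff₀ (by positivity) (by positivity), mul_pow, mul_pow]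
  calc _ ≤ A ^ (∑ j, β j) * R ^ (∑ j, β j) *
        (((d : ℝ) ^ s) ^ (∑ j, β j) * ((∏ j, (β j).factorial : ℕ) : ℝ) ^ s) := by gcongr
    _ = _ := by ring

/-! ### The jet embedding into a space of bounded functions -/

/-- The space of bounded families indexed by multi-indices and points of `K`. -/
abbrev JetSpace (K : Set (Rd d)) : Type :=
  lp (fun _ : (Fin d → ℕ) × K => ℂ) ∞

/-- The embedding of `𝓔^{(s)}` with the norm `‖·‖_{s,A,K}` into a Banach space, sending `g` to the
family of all its normalized partial derivatives on `K`. -/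
noncomputable def jet {s A : ℝ} (hA : 0 < A) {K : Set (Rd d)} (hK : IsCompact K) :
    smoothSpace d s →ₗ[ℂ] JetSpace K where
  toFun g := ⟨fun i => (gevreyFactor s A i.1 : ℂ) * pderiv i.1 (g : Rd d → ℂ) i.2, by
    obtain ⟨C, _, h⟩ := gevreyNorm_lt_top_iff.1 (g.2.2 K hK A hA)
    refine memℓp_infty ⟨C, ?_⟩
    rintro _ ⟨i, rfl⟩
    dsimp only
    rw [norm_mul, Complex.norm_real, Real.norm_of_nonneg (gevreyFactor_pos hA _).le]
    exact h i.1 i.2 i.2.2⟩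
  map_add' g h := by
    refine lp.ext (funext fun i => ?_)
    change (gevreyFactor s A i.1 : ℂ) * pderiv i.1 ((g : Rd d → ℂ) + (h : Rd d → ℂ)) i.2 =
      (gevreyFactor s A i.1 : ℂ) * pderiv i.1 (g : Rd d → ℂ) i.2 +
      (gevreyFactor s A i.1 : ℂ) * pderiv i.1 (h : Rd d → ℂ) i.2
    rw [pderiv_add g.2.1 h.2.1, mul_add]
  map_smul' c g := by
    refine lp.ext (funext fun i => ?_)
    change (gevreyFactor s A i.1 : ℂ) * pderiv i.1 (c • (g : Rd d → ℂ)) i.2 =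
      c * ((gevreyFactor s A i.1 : ℂ) * pderiv i.1 (g : Rd d → ℂ) i.2)
    rw [pderiv_smul g.2.1, mul_left_comm]

theorem jet_apply {s A : ℝ} (hA : 0 < A) {K : Set (Rd d)} (hK : IsCompact K)
    (g : smoothSpace d s) (i : (Fin d → ℕ) × K) :
    jet hA hK g i = (gevreyFactor s A i.1 : ℂ) * pderiv i.1 (g : Rd d → ℂ) i.2 := rfl

theorem gevreyNorm_le_norm_jet {s A : ℝ} (hA : 0 < A) {K : Set (Rd d)} (hK : IsCompact K)
    (g : smoothSpace d s) :
    gevreyNorm s A K (g : Rd d → ℂ) ≤ ENNReal.ofReal ‖jet hA hK g‖ := by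
  rw [gevreyNorm_le_ofReal_iff (norm_nonneg _)]
  intro β x hx
  have h := lp.norm_apply_le_norm ENNReal.top_ne_zero (jet hA hK g) (β, ⟨x, hx⟩)
  rwa [jet_apply, norm_mul, Complex.norm_real,
    Real.norm_of_nonneg (gevreyFactor_pos hA _).le] at h

/-- An ultradistribution with compact support factors through a jet embedding. -/
theorem exists_eq_comp_jet {s : ℝ} (u : CompactUltradistribution d s) :
    ∃ (K : Set (Rd d)) (hK : IsCompact K) (A : ℝ) (hA : 0 < A) (U : JetSpace K →L[ℂ] ℂ),
      ∀ g, u.toLin g = U (jet hA hK g) := by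
  obtain ⟨K, A, C, hK, hA, hu⟩ := u.cont
  have hb : ∀ g, ‖u.toLin g‖ ≤ C * ‖jet hA hK g‖ := by
    intro g
    have h := (hu g).trans (mul_le_mul_right (gevreyNorm_le_norm_jet hA hK g) _)
    rw [← ofReal_norm, ← ENNReal.ofReal_coe_nnreal, ← ENNReal.ofReal_mul C.coe_nonneg] at h
    exact (ENNReal.ofReal_le_ofReal_iff (by positivity)).1 h
  -- The jet map need not be injective, since it sees only `K`; the norm bound makes `u` vanish on
  -- its kernel, so `u` descends to the range.
  have hker : LinearMap.ker (jet (s := s) hA hK) ≤ LinearMap.ker u.toLin := by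
    intro g hg
    rw [LinearMap.mem_ker] at hg ⊢
    have h := hb g
    rw [hg, norm_zero, mul_zero] at h
    exact norm_le_zero_iff.1 h
  let U₀ : LinearMap.range (jet (s := s) hA hK) →ₗ[ℂ] ℂ :=
    ((LinearMap.ker (jet (s := s) hA hK)).liftQ u.toLin hker) ∘ₗ
      (jet (s := s) hA hK).quotKerEquivRange.symm.toLinearMap
  have hU₀ : ∀ g, U₀ ⟨jet hA hK g, LinearMap.mem_range_self _ g⟩ = u.toLin g := by
    intro g
    have : (jet (s := s) hA hK).quotKerEquivRange.symm
        ⟨jet hA hK g, LinearMap.mem_range_self _ g⟩ = Submodule.Quotient.mk g := by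
      rw [LinearEquiv.symm_apply_eq]
      rfl
    simp only [U₀, LinearMap.comp_apply, LinearEquiv.coe_coe, this]
    exact Submodule.liftQ_apply _ _ _
  let U₁ : StrongDual ℂ (LinearMap.range (jet (s := s) hA hK)) := U₀.mkContinuous C (by
    rintro ⟨_, g, rfl⟩
    rw [hU₀]
    exact hb g)
  -- Hahn–Banach. Only boundedness of the extension matters: it lets `U` commute with Bochner
  -- integrals.
  obtain ⟨U, hU, _⟩ := exists_extension_norm_eq _ U₁
  exact ⟨K, hK, A, hA, U, fun g => by
    rw [← hU₀]
    exact (hU ⟨jet hA hK g, LinearMap.mem_range_self _ g⟩).symm⟩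

/-! ### Exponentials in the jet space; continuity and growth of the Fourier transform -/

section Exponentials

variable {s : ℝ} (hs : 1 ≤ s) {A : ℝ} (hA : 0 < A) {K : Set (Rd d)} (hK : IsCompact K)

/-- The exponential `e^{-i⟨·,ξ⟩}` as an element of `𝓔^{(s)}`. -/
noncomputable def expElt (ξ : Rd d) : smoothSpace d s := ⟨expFun ξ, expFun_mem_smoothSpace hs ξ⟩

theorem norm_jet_expElt_le (ξ : Rd d) : ‖jet hA hK (expElt hs ξ)‖ ≤
    Real.exp (s * (A * (d : ℝ) ^ s * ‖ξ‖) ^ (1 / s)) := by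
  refine lp.norm_le_of_forall_le (Real.exp_pos _).le fun i => ?_
  rw [jet_apply, norm_mul, Complex.norm_real, Real.norm_of_nonneg (gevreyFactor_pos hA _).le]
  refine le_trans ?_ (gevreyFactor_mul_pow_le (by linarith) hA (norm_nonneg ξ) i.1)
  have := gevreyFactor_pos (s := s) hA i.1
  gcongr
  exact norm_pderiv_expFun_le _ _ _

/-- Locally Lipschitz near `τ`: on the ball of radius `R = ‖τ‖ + 1` the derivatives of order `β`
differ by at most `(2R)^{|β|}` times `(1 + ‖x‖)‖ξ - τ‖`, and the Gevrey factor makes this uniform in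
`β`. The continuity supplies the measurability needed for integrals over frequencies. -/
theorem continuous_jet_expElt : Continuous fun ξ : Rd d => jet hA hK (expElt hs ξ) := by
  obtain ⟨M, hM⟩ := hK.isBounded.exists_norm_le
  rw [continuous_iff_continuousAt]
  intro τ
  set R := ‖τ‖ + 1
  set L := Real.exp (s * (A * (d : ℝ) ^ s * (2 * R)) ^ (1 / s)) * (1 + |M|)
  have hR : 1 ≤ R := le_add_of_nonneg_left (norm_nonneg τ)
  refine continuousAt_of_locally_lipschitz one_pos L fun ξ hξ => ?_
  rw [dist_eq_norm] at hξ
  rw [dist_eq_norm, dist_eq_norm]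
  refine lp.norm_le_of_forall_le (by positivity) fun i => ?_
  have hx : ‖(i.2 : Rd d)‖ ≤ |M| := (hM _ i.2.2).trans (le_abs_self M)
  have hξR : ‖ξ‖ ≤ R := by
    have := norm_le_norm_add_norm_sub τ ξ
    rw [← norm_sub_rev] at this
    linarith
  have h1 := norm_pderiv_expFun_sub_le i.1 (i.2 : Rd d) hR hξR
    (le_add_of_nonneg_right zero_le_one : ‖τ‖ ≤ R)
  have h2 := gevreyFactor_mul_pow_le (s := s) (by linarith) hA (by positivity : 0 ≤ 2 * R) i.1
  have h3 := gevreyFactor_pos (s := s) hA i.1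
  rw [lp.coeFn_sub, Pi.sub_apply, jet_apply, jet_apply, ← mul_sub, norm_mul, Complex.norm_real,
    Real.norm_of_nonneg h3.le]
  calc _ ≤ gevreyFactor s A i.1 * ((2 * R) ^ (∑ j, i.1 j) *
          ((1 + ‖(i.2 : Rd d)‖) * ‖ξ - τ‖)) := by
        gcongr
        exact h1
    _ = (gevreyFactor s A i.1 * (2 * R) ^ (∑ j, i.1 j)) *
          ((1 + ‖(i.2 : Rd d)‖) * ‖ξ - τ‖) := by ring
    _ ≤ Real.exp (s * (A * (d : ℝ) ^ s * (2 * R)) ^ (1 / s)) * ((1 + |M|) * ‖ξ - τ‖) := by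
        gcongr
    _ = _ := by ring

theorem continuous_apply_expElt (u : CompactUltradistribution d s) :
    Continuous fun ξ : Rd d => u.toLin (expElt hs ξ) := by
  obtain ⟨K, hK, A, hA, U, hU⟩ := exists_eq_comp_jet u
  simp only [hU]
  exact U.continuous.comp (continuous_jet_expElt hs hA hK)

/-- The Fourier transform of an ultradistribution with compact support grows at most like
`e^{k|·|^{1/s}}`. -/
theorem norm_apply_expElt_le (u : CompactUltradistribution d s) :
    ∃ C k : ℝ, 0 ≤ C ∧ 0 ≤ k ∧ ∀ ξ : Rd d,
      ‖u.toLin (expElt hs ξ)‖ ≤ C * Real.exp (k * ‖ξ‖ ^ (1 / s)) := by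
  obtain ⟨K, hK, A, hA, U, hU⟩ := exists_eq_comp_jet u
  refine ⟨‖U‖, s * (A * (d : ℝ) ^ s) ^ (1 / s), norm_nonneg _, by positivity, fun ξ => ?_⟩
  rw [hU, mul_assoc, ← Real.mul_rpow (by positivity) (norm_nonneg _)]
  exact (U.le_opNorm _).trans (by gcongr; exact norm_jet_expElt_le hs hA hK ξ)

end Exponentials

end UltraWF

namespace UltraWF

variable {d : ℕ} {s : ℝ} {X : Set (Rd d)}

/-! ### Fourier inversion in the Gevrey topology -/

theorem continuous_fourierInv_of_mem_testSpace {h : Rd d → ℂ} (hh : h ∈ testSpace d s X) :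
    Continuous (𝓕⁻ h) := by
  have hi : Integrable h := hh.1.continuous.integrable_of_hasCompactSupport
    (hasCompactSupport_of_mem_testSpace hh)
  have hc : Continuous (𝓕 h) := VectorFourier.fourierIntegral_continuous
    Real.continuous_fourierChar (L := innerₗ (Rd d)) continuous_inner hi
  have e : 𝓕⁻ h = fun w => 𝓕 h (-w) := funext fun w => Real.fourierInv_eq_fourier_neg h w
  rw [e]
  exact hc.comp continuous_neg

theorem exp_neg_two_pi_mul_le (hs : 0 < s) {N : ℝ} (hN : 0 ≤ N) (w : Rd d) :
    Real.exp (-(N * (2 * Real.pi * ‖w‖) ^ (1 / s))) ≤ Real.exp (-(N * ‖w‖ ^ (1 / s))) := by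
  have h1 : ‖w‖ ≤ 2 * Real.pi * ‖w‖ :=
    le_mul_of_one_le_left (norm_nonneg w) (by linarith [Real.pi_gt_three])
  gcongr

theorem integrable_pow_mul_fourierInv (hs : 0 < s) {h : Rd d → ℂ} (hh : h ∈ testSpace d s X)
    (n : ℕ) : Integrable fun w : Rd d => ‖w‖ ^ n * ‖𝓕⁻ h w‖ := by
  -- Of the rate `s + 1`, the part `s` compensates `‖w‖^n` and the part `1` remains for
  -- integrability.
  obtain ⟨C, hC, hb⟩ := norm_fourierInv_le_exp hs hh (N := s + 1) (by linarith)
  refine ((integrable_exp_neg_norm_rpow (d := d) hs one_pos).const_mul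
    ((n.factorial : ℝ) ^ s * C)).mono' ?_ (Filter.Eventually.of_forall fun w => ?_)
  · exact ((continuous_norm.pow n).mul
      (continuous_fourierInv_of_mem_testSpace hh).norm).aestronglyMeasurable
  · have h1 := pow_div_factorial_rpow_le_exp hs (norm_nonneg w) n
    have hn : (0 : ℝ) < n.factorial := by exact_mod_cast n.factorial_pos
    rw [div_le_iff₀ (by positivity)] at h1
    have h2 := (hb w).trans
      (mul_le_mul_of_nonneg_left (exp_neg_two_pi_mul_le hs (by linarith) w) hC)
    rw [Real.norm_of_nonneg (by positivity)]
    calc _ ≤ (Real.exp (s * ‖w‖ ^ (1 / s)) * (n.factorial : ℝ) ^ s) *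
          (C * Real.exp (-((s + 1) * ‖w‖ ^ (1 / s)))) := by gcongr
      _ = (n.factorial : ℝ) ^ s * C * (Real.exp (s * ‖w‖ ^ (1 / s)) *
          Real.exp (-((s + 1) * ‖w‖ ^ (1 / s)))) := by ring
      _ = _ := by
          rw [← Real.exp_add]
          congr 2
          ring

theorem integrable_fourierInv (hs : 0 < s) {h : Rd d → ℂ} (hh : h ∈ testSpace d s X) :
    Integrable (𝓕⁻ h) := by
  have h1 := integrable_pow_mul_fourierInv hs hh 0
  simp only [pow_zero, one_mul] at h1
  exact (integrable_norm_iff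
    (continuous_fourierInv_of_mem_testSpace hh).aestronglyMeasurable).1 h1

theorem fourierChar_smul_eq_expFun (ζ x : Rd d) (c : ℂ) :
    Real.fourierChar (-(inner ℝ ζ x)) • c = expFun ((2 * Real.pi) • ζ) x * c := by
  rw [Circle.smul_def, Real.fourierChar_apply, smul_eq_mul, expFun, inner_smul_right,
    real_inner_comm]
  congr 2
  push_cast
  ring

/-- The partial derivatives of a test function as superpositions of those of exponentials. -/
theorem pderiv_eq_integral (hs : 0 < s) {h : Rd d → ℂ} (hh : h ∈ testSpace d s X)
    (β : Fin d → ℕ) (x : Rd d) :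
    pderiv β h x = ∫ ζ : Rd d, 𝓕⁻ h ζ * pderiv β (expFun ((2 * Real.pi) • ζ)) x := by
  have hi : Integrable h := hh.1.continuous.integrable_of_hasCompactSupport
    (hasCompactSupport_of_mem_testSpace hh)
  have hg := integrable_fourierInv hs hh
  have hinv : 𝓕 (𝓕⁻ h) = h := hh.1.continuous.fourier_fourierInv_eq hi
    ((integrable_fourierInv hs hh).comp_neg.congr (Filter.Eventually.of_forall fun w => by
      simp [Real.fourierInv_eq_fourier_neg]))
  -- All moments of `𝓕⁻ h` are finite, so the inversion formula can be differentiated under the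
  -- integral sign.
  have hder := congrFun (Real.iteratedFDeriv_fourier (f := 𝓕⁻ h) (N := ⊤)
    (fun n _ => integrable_pow_mul_fourierInv hs hh n) hg.aestronglyMeasurable
    (n := ∑ j, β j) le_top) x
  have hint : Integrable fun v : Rd d =>
      VectorFourier.fourierPowSMulRight (innerSL ℝ) (𝓕⁻ h) v (∑ j, β j) :=
    VectorFourier.integrable_fourierPowSMulRight _ (integrable_pow_mul_fourierInv hs hh _)
      hg.aestronglyMeasurable
  rw [hinv] at hder
  unfold pderiv
  rw [hder, Real.fourier_continuousMultilinearMap_apply hint, Real.fourier_eq]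
  refine integral_congr_ae (Filter.Eventually.of_forall fun ζ => ?_)
  dsimp only
  rw [VectorFourier.fourierPowSMulRight_apply, fourierChar_smul_eq_expFun,
    iteratedFDeriv_expFun_apply]
  have e : ∀ v : Rd d, -Complex.I * ((inner ℝ ((2 * Real.pi) • ζ) v : ℝ) : ℂ) =
      -(2 * (Real.pi : ℂ) * Complex.I) * ((inner ℝ ζ v : ℝ) : ℂ) := by
    intro v
    rw [real_inner_smul_left]
    push_cast
    ring
  rw [Finset.prod_congr rfl fun i _ => e _, Finset.prod_mul_distrib, Finset.prod_const, Finset.card_univ, Fintype.card_fin,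
    Complex.real_smul, smul_eq_mul, Complex.ofReal_prod]
  simp only [show ∀ v : Rd d, (innerSL ℝ ζ) v = inner ℝ ζ v from fun _ => rfl]
  ring

theorem integrable_fourierInv_smul_jet (hs : 1 ≤ s) {h : Rd d → ℂ} (hh : h ∈ testSpace d s X)
    {A : ℝ} (hA : 0 < A) {K : Set (Rd d)} (hK : IsCompact K) :
    Integrable fun ζ : Rd d => 𝓕⁻ h ζ • jet hA hK (expElt hs ((2 * Real.pi) • ζ)) := by
  have hs0 : 0 < s := by linarith
  set k := s * (A * (d : ℝ) ^ s) ^ (1 / s)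
  have hk : 0 ≤ k := by positivity
  -- The rate `k` cancels the growth of the jets of the exponentials; the extra `1` gives
  -- integrability.
  obtain ⟨C, hC, hb⟩ := norm_fourierInv_le_exp hs0 hh (N := k + 1) (by linarith)
  have hpi := Real.pi_pos
  refine ((integrable_exp_neg_norm_rpow (d := d) hs0 one_pos).const_mul C).mono' ?_
    (Filter.Eventually.of_forall fun w => ?_)
  · exact ((continuous_fourierInv_of_mem_testSpace hh).smul
      ((continuous_jet_expElt hs hA hK).comp (continuous_const_smul _))).aestronglyMeasurable
  · rw [norm_smul]
    have h1 := norm_jet_expElt_le hs hA hK ((2 * Real.pi) • w)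
    rw [norm_smul, Real.norm_of_nonneg (by positivity),
      Real.mul_rpow (by positivity) (by positivity), ← mul_assoc] at h1
    calc _ ≤ (C * Real.exp (-((k + 1) * (2 * Real.pi * ‖w‖) ^ (1 / s)))) *
          Real.exp (k * (2 * Real.pi * ‖w‖) ^ (1 / s)) := by
          gcongr
          exact hb w
      _ = C * Real.exp (-(1 * (2 * Real.pi * ‖w‖) ^ (1 / s))) := by
          rw [mul_assoc, ← Real.exp_add]
          congr 2
          ring
      _ ≤ _ := by
          gcongr C * ?_
          exact exp_neg_two_pi_mul_le hs0 zero_le_one w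

/-- The value of an ultradistribution on a test function in terms of its Fourier transform. -/
theorem apply_eq_integral (hs : 1 ≤ s) (u : CompactUltradistribution d s) {h : Rd d → ℂ}
    (hh : h ∈ testSpace d s X) :
    u.toLin ⟨h, testSpace_le_smoothSpace d s X hh⟩ =
      ∫ ζ : Rd d, 𝓕⁻ h ζ * u.toLin (expElt hs ((2 * Real.pi) • ζ)) := by
  obtain ⟨K, hK, A, hA, U, hU⟩ := exists_eq_comp_jet u
  have hint := integrable_fourierInv_smul_jet hs hh hA hK
  -- Equality in the jet space is checked coordinate by coordinate: evaluations are continuous and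
  -- pass through the Bochner integral, leaving the scalar inversion formula.
  have hjet : jet hA hK ⟨h, testSpace_le_smoothSpace d s X hh⟩ =
      ∫ ζ : Rd d, 𝓕⁻ h ζ • jet hA hK (expElt hs ((2 * Real.pi) • ζ)) := by
    refine lp.ext (funext fun i => ?_)
    have e := (lp.evalCLM ℂ (fun _ : (Fin d → ℕ) × K => ℂ) ∞ i).integral_comp_comm hint
    refine Eq.trans ?_ e
    rw [jet_apply, pderiv_eq_integral (by linarith) hh, ← integral_const_mul]
    refine integral_congr_ae (Filter.Eventually.of_forall fun ζ => ?_)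
    change _ = 𝓕⁻ h ζ * ((gevreyFactor s A i.1 : ℂ) *
      pderiv i.1 (expFun ((2 * Real.pi) • ζ)) i.2)
    ring
  rw [hU, hjet, ← U.integral_comp_comm hint]
  refine integral_congr_ae (Filter.Eventually.of_forall fun ζ => ?_)
  dsimp only
  rw [map_smul, hU, smul_eq_mul]

/-! ### Localization acts on the Fourier side by convolution -/

/-- Modulation becomes translation; the factor `(2π)⁻¹` converts between `e^{-i⟨x,ξ⟩}` and the
normalization of `𝓕⁻`. -/
theorem fourierInv_mul_expFun (η : Rd d → ℂ) (ξ ζ : Rd d) :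
    𝓕⁻ (η * expFun ξ) ζ = 𝓕⁻ η (ζ - (2 * Real.pi)⁻¹ • ξ) := by
  rw [Real.fourierInv_eq', Real.fourierInv_eq']
  refine integral_congr_ae (Filter.Eventually.of_forall fun x => ?_)
  dsimp only
  rw [Pi.mul_apply, expFun, smul_eq_mul, smul_eq_mul, mul_left_comm, ← Complex.exp_add, mul_comm,
    inner_sub_right, inner_smul_right]
  congr 2
  have hpi : (Real.pi : ℂ) ≠ 0 := by exact_mod_cast Real.pi_ne_zero
  push_cast
  field_simp
  ring

theorem lintegral_comp_smul_eq {c : ℝ} (hc : 0 < c) {F : Rd d → ℝ≥0∞} (hF : Measurable F) :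
    ∫⁻ ζ, F (c • ζ) = ENNReal.ofReal ((c ^ d)⁻¹) * ∫⁻ τ, F τ := by
  rw [← lintegral_map hF (measurable_const_smul c), Measure.map_addHaar_smul volume hc.ne',
    lintegral_smul_measure, finrank_euclideanSpace_fin, abs_of_nonneg (by positivity), smul_eq_mul]

/-- Inversion of `η e^{-i⟨·,ξ⟩}`, followed by the substitution `τ = 2πζ`, turns multiplication by
`η` into a convolution bound. The constant does not depend on `ξ`, as only a translate of `𝓕⁻ η`
enters. -/
theorem exists_enorm_apply_mul_expFun_le (hs : 1 ≤ s) (u : CompactUltradistribution d s)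
    {η : Rd d → ℂ} (hη : η ∈ testSpace d s X) {N : ℝ} (hN : 0 < N) :
    ∃ C : ℝ≥0, ∀ (ξ : Rd d) (h : η * expFun ξ ∈ smoothSpace d s),
      ‖u.toLin ⟨η * expFun ξ, h⟩‖ₑ ≤
        C * ∫⁻ τ, ENNReal.ofReal (Real.exp (-(N * ‖ξ - τ‖ ^ (1 / s)))) *
          ‖u.toLin (expElt hs τ)‖ₑ := by
  obtain ⟨C, hC, hb⟩ := norm_fourierInv_le_exp (by linarith) hη hN
  have hpi := Real.pi_pos
  refine ⟨(C * ((2 * Real.pi) ^ d)⁻¹).toNNReal, fun ξ h => ?_⟩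
  have hmem : η * expFun ξ ∈ testSpace d s univ :=
    mul_mem_testSpace (by linarith) (subset_univ X) hη (expFun_mem_smoothSpace hs ξ)
  set F : Rd d → ℝ≥0∞ := fun τ => ENNReal.ofReal (Real.exp (-(N * ‖ξ - τ‖ ^ (1 / s)))) *
    ‖u.toLin (expElt hs τ)‖ₑ
  have hF : Measurable F := by
    refine Measurable.mul ?_ (continuous_apply_expElt hs u).measurable.enorm
    refine (ENNReal.continuous_ofReal.comp (Real.continuous_exp.comp
      (continuous_const.mul ?_).neg)).measurable
    exact (continuous_const.sub continuous_id).norm.rpow_const fun _ => Or.inr (by positivity)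
  rw [apply_eq_integral hs u hmem]
  refine (enorm_integral_le_lintegral_enorm _).trans ?_
  calc _ ≤ ∫⁻ ζ : Rd d, ENNReal.ofReal C * F ((2 * Real.pi) • ζ) := by
        refine lintegral_mono fun ζ => ?_
        rw [enorm_mul, ← mul_assoc, ← ENNReal.ofReal_mul hC]
        gcongr
        rw [← ofReal_norm, fourierInv_mul_expFun]
        refine ENNReal.ofReal_le_ofReal ((hb _).trans_eq ?_)
        congr 5
        have e : ξ - (2 * Real.pi) • ζ = -((2 * Real.pi) • (ζ - (2 * Real.pi)⁻¹ • ξ)) := by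
          rw [smul_sub, smul_smul, mul_inv_cancel₀ (by positivity), one_smul, neg_sub]
        rw [e, norm_neg, norm_smul, Real.norm_of_nonneg (by positivity)]
    _ = _ := by
        rw [lintegral_const_mul' _ _ ENNReal.ofReal_ne_top,
          lintegral_comp_smul_eq (by positivity) hF, ← mul_assoc, ← ENNReal.ofReal_mul hC]
        rfl

end UltraWF

namespace UltraWF

variable {d : ℕ} {s : ℝ}

/-! ### A convolution inequality -/

/-- For finite `q`, pointwise `H^q ≤ B^{q-p} H^p`. No measurability of `H` is required. -/
theorem eLpNorm_lt_top_of_le_of_lintegral_lt_top {α : Type*} [MeasurableSpace α] {μ : Measure α}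
    {H : α → ℝ≥0∞} {B : ℝ≥0∞} (hB : B ≠ ⊤) (hHB : ∀ x, H x ≤ B) {p : ℝ} (hp : 0 < p)
    (hH : ∫⁻ x, H x ^ p ∂μ < ⊤) {q : ℝ≥0∞} (hpq : ENNReal.ofReal p ≤ q) :
    eLpNorm H q μ < ⊤ := by
  have hq0 : q ≠ 0 := ((ENNReal.ofReal_pos.2 hp).trans_le hpq).ne'
  rcases eq_or_ne q ⊤ with rfl | hq
  · rw [eLpNorm_exponent_top]
    exact (eLpNormEssSup_le_of_ae_enorm_bound
      (Filter.Eventually.of_forall hHB)).trans_lt hB.lt_top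
  · rw [eLpNorm_lt_top_iff_lintegral_rpow_enorm_lt_top hq0 hq]
    have hpq' : p ≤ q.toReal := (ENNReal.ofReal_le_iff_le_toReal hq).1 hpq
    calc _ ≤ ∫⁻ x, B ^ (q.toReal - p) * H x ^ p ∂μ := by
          refine lintegral_mono fun x => ?_
          have e : q.toReal = (q.toReal - p) + p := by ring
          rw [enorm_eq_self, e, ENNReal.rpow_add_of_nonneg _ _ (by linarith) hp.le,
            add_sub_cancel_right]
          gcongr
          exact hHB x
      _ < ⊤ := by
          have hBt : B ^ (q.toReal - p) ≠ ⊤ := ENNReal.rpow_ne_top_of_nonneg (by linarith) hB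
          rw [lintegral_const_mul' _ _ hBt]
          exact ENNReal.mul_lt_top hBt.lt_top hH

/-- Hölder's inequality for `F` against the constant `1`, with respect to the measure of density
`g`. -/
theorem lintegral_mul_rpow_le {α : Type*} [MeasurableSpace α] {μ : Measure α} {g F : α → ℝ≥0∞}
    (hg : Measurable g) (hF : Measurable F) {p : ℝ} (hp : 1 ≤ p) :
    (∫⁻ x, g x * F x ∂μ) ^ p ≤ (∫⁻ x, g x * F x ^ p ∂μ) * (∫⁻ x, g x ∂μ) ^ (p - 1) := by
  have hp0 : 0 < p := by linarith
  have h := eLpNorm_le_eLpNorm_mul_rpow_measure_univ (μ := μ.withDensity g) (f := F) (p := 1)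
    (q := ENNReal.ofReal p) (by rw [← ENNReal.ofReal_one]; exact ENNReal.ofReal_le_ofReal hp)
    hF.aestronglyMeasurable
  rw [eLpNorm_one_eq_lintegral_enorm, eLpNorm_eq_lintegral_rpow_enorm_toReal
    (ENNReal.ofReal_pos.2 hp0).ne' ENNReal.ofReal_ne_top, ENNReal.toReal_ofReal hp0.le] at h
  simp only [enorm_eq_self] at h
  rw [lintegral_withDensity_eq_lintegral_mul _ hg hF,
    lintegral_withDensity_eq_lintegral_mul _ hg (hF.pow_const p),
    withDensity_apply _ MeasurableSet.univ, setLIntegral_univ] at h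
  have h2 := ENNReal.rpow_le_rpow h hp0.le
  rw [ENNReal.mul_rpow_of_nonneg _ _ hp0.le, ← ENNReal.rpow_mul, ← ENNReal.rpow_mul,
    one_div_mul_cancel hp0.ne', ENNReal.rpow_one] at h2
  have e : (1 / (1 : ℝ≥0∞).toReal - 1 / p) * p = p - 1 := by
    rw [ENNReal.toReal_one]
    field_simp
  rw [e] at h2
  exact h2

/-- Convolution with a bounded integrable kernel maps `L^r` into `L^q` for `r ≤ q`. -/
theorem eLpNorm_convolution_lt_top {G F : Rd d → ℝ≥0∞} (hG : Measurable G) (hF : Measurable F)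
    {M : ℝ≥0∞} (hM : M ≠ ⊤) (hGM : ∀ x, G x ≤ M) (hGi : ∫⁻ x, G x ≠ ⊤) {q r : ℝ≥0∞}
    (hr : 1 ≤ r) (hrq : r ≤ q) (hFr : eLpNorm F r volume < ⊤) :
    eLpNorm (fun ξ => ∫⁻ τ, G (ξ - τ) * F τ) q volume < ⊤ := by
  have hGs : ∀ ξ : Rd d, ∫⁻ τ, G (ξ - τ) = ∫⁻ τ, G τ := fun ξ =>
    lintegral_sub_left_eq_self G ξ
  have hGm : ∀ ξ : Rd d, Measurable fun τ => G (ξ - τ) := fun ξ =>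
    hG.comp (measurable_const.sub measurable_id)
  rcases eq_or_ne r ⊤ with rfl | hrt
  · obtain rfl : q = ⊤ := top_le_iff.1 hrq
    rw [eLpNorm_exponent_top] at hFr ⊢
    refine (eLpNormEssSup_le_of_ae_enorm_bound (C := (∫⁻ τ, G τ) * eLpNormEssSup F volume)
      (Filter.Eventually.of_forall fun ξ => ?_)).trans_lt (ENNReal.mul_lt_top hGi.lt_top hFr)
    rw [enorm_eq_self, ← hGs ξ, ← lintegral_mul_const _ (hGm ξ)]
    refine lintegral_mono_ae ?_
    filter_upwards [ae_le_eLpNormEssSup (f := F) (μ := volume)] with τ hτ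
    gcongr
    exact hτ
  · set p := r.toReal
    have hp : 1 ≤ p := by
      rw [← ENNReal.toReal_one]
      exact ENNReal.toReal_mono hrt hr
    have hp0 : 0 < p := by linarith
    rw [eLpNorm_lt_top_iff_lintegral_rpow_enorm_lt_top (by positivity) hrt] at hFr
    simp only [enorm_eq_self] at hFr
    set I := ∫⁻ τ, F τ ^ p
    set S := ∫⁻ τ, G τ
    have hS : S ^ (p - 1) ≠ ⊤ := ENNReal.rpow_ne_top_of_nonneg (by linarith) hGi
    have hJ : ∀ ξ : Rd d, (∫⁻ τ, G (ξ - τ) * F τ) ^ p ≤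
        (∫⁻ τ, G (ξ - τ) * F τ ^ p) * S ^ (p - 1) := by
      intro ξ
      have := lintegral_mul_rpow_le (μ := volume) (hGm ξ) hF hp
      rwa [hGs] at this
    -- For finite `r` the convolution is both bounded, from `hJ` and `G ≤ M`, and in `L^r`, from
    -- `hJ` and Tonelli; every exponent `q ≥ r` follows.
    refine eLpNorm_lt_top_of_le_of_lintegral_lt_top (B := (M * I * S ^ (p - 1)) ^ p⁻¹) (p := p)
      ?_ (fun ξ => ?_) hp0 ?_ ?_
    · exact ENNReal.rpow_ne_top_of_nonneg (by positivity)
        (ENNReal.mul_ne_top (ENNReal.mul_ne_top hM hFr.ne) hS)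
    · rw [ENNReal.le_rpow_inv_iff hp0]
      refine (hJ ξ).trans ?_
      gcongr
      rw [← lintegral_const_mul _ (hF.pow_const p)]
      exact lintegral_mono fun τ => by gcongr; exact hGM _
    · have hmeas : Measurable fun z : Rd d × Rd d => G (z.1 - z.2) * F z.2 ^ p :=
        (hG.comp (measurable_fst.sub measurable_snd)).mul ((hF.comp measurable_snd).pow_const p)
      calc _ ≤ ∫⁻ ξ : Rd d, (∫⁻ τ, G (ξ - τ) * F τ ^ p) * S ^ (p - 1) := lintegral_mono hJ
        _ = (∫⁻ ξ : Rd d, ∫⁻ τ, G (ξ - τ) * F τ ^ p) * S ^ (p - 1) :=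
            lintegral_mul_const' _ _ hS
        _ = (∫⁻ τ : Rd d, ∫⁻ ξ, G (ξ - τ) * F τ ^ p) * S ^ (p - 1) := by
            rw [lintegral_lintegral_swap hmeas.aemeasurable]
        _ = (S * I) * S ^ (p - 1) := by
            congr 1
            rw [← lintegral_const_mul _ (hF.pow_const p)]
            refine lintegral_congr fun τ => ?_
            have hm : Measurable fun ξ : Rd d => G (ξ - τ) := hG.comp (measurable_id.sub_const τ)
            rw [lintegral_mul_const _ hm]
            congr 1
            exact lintegral_sub_right_eq_self G τ
        _ < ⊤ := ENNReal.mul_lt_top (ENNReal.mul_lt_top hGi.lt_top hFr) hS.lt_top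
    · rwa [ENNReal.ofReal_toReal hrt]

/-! ### Cones -/

/-- Take the cone over a ball around `ξ₀` of half the radius of one inside `Γ`. Scaling by `t` so
that `tξ` is in the half ball leaves `tτ` outside the full ball: thus `‖tξ - tτ‖ ≥ ρ/2` while `‖tξ‖
≤ ‖ξ₀‖ + ρ/2`, and the quotient of these bounds is the constant. -/
theorem IsOpenCone.exists_subcone {Γ : Set (Rd d)} (hΓ : IsOpenCone Γ) {ξ₀ : Rd d}
    (hξ₀ : ξ₀ ∈ Γ) : ∃ Γ' : Set (Rd d), IsOpenCone Γ' ∧ ξ₀ ∈ Γ' ∧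
      ∃ c : ℝ, 0 < c ∧ ∀ ξ ∈ Γ', ∀ τ ∉ Γ, c * ‖ξ‖ ≤ ‖ξ - τ‖ := by
  obtain ⟨hopen, h0, hcone⟩ := hΓ
  obtain ⟨ρ, hρ, hball⟩ := Metric.isOpen_iff.1 hopen ξ₀ hξ₀
  have hsub : Metric.ball ξ₀ (ρ / 2) ⊆ Γ := (Metric.ball_subset_ball (by linarith)).trans hball
  refine ⟨⋃ t ∈ Ioi (0 : ℝ), (fun ξ => t • ξ) ⁻¹' Metric.ball ξ₀ (ρ / 2), ⟨?_, ?_, ?_⟩, ?_,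
    ρ / 2 / (‖ξ₀‖ + ρ / 2), by positivity, ?_⟩
  · exact isOpen_biUnion fun t _ => Metric.isOpen_ball.preimage (continuous_const_smul t)
  · simp only [mem_iUnion, mem_preimage, smul_zero, not_exists]
    exact fun t _ h => h0 (hsub h)
  · intro ξ hξ t ht
    simp only [mem_iUnion, mem_preimage, exists_prop, mem_Ioi] at hξ ⊢
    obtain ⟨a, ha, h⟩ := hξ
    refine ⟨a / t, by positivity, ?_⟩
    rwa [smul_smul, div_mul_cancel₀ _ ht.ne']
  · simp only [mem_iUnion, mem_preimage, exists_prop, mem_Ioi]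
    exact ⟨1, one_pos, by simpa using hρ⟩
  · intro ξ hξ τ hτ
    simp only [mem_iUnion, mem_preimage, exists_prop, mem_Ioi] at hξ
    obtain ⟨t, ht, h⟩ := hξ
    have hτ' : t • τ ∉ Metric.ball ξ₀ ρ := fun h' => hτ (by
      have := hcone _ (hball h') t⁻¹ (inv_pos.2 ht)
      rwa [smul_smul, inv_mul_cancel₀ ht.ne', one_smul] at this)
    rw [Metric.mem_ball, dist_eq_norm] at h
    rw [Metric.mem_ball, dist_eq_norm, not_lt] at hτ'
    have h1 : t * ‖ξ‖ ≤ ‖ξ₀‖ + ρ / 2 := by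
      rw [← Real.norm_of_nonneg ht.le, ← norm_smul]
      have := norm_le_norm_add_norm_sub ξ₀ (t • ξ)
      rw [norm_sub_rev] at this
      linarith
    have h2 : ρ / 2 ≤ t * ‖ξ - τ‖ := by
      rw [← Real.norm_of_nonneg ht.le, ← norm_smul, smul_sub]
      have := norm_sub_le_norm_sub_add_norm_sub (t • τ) (t • ξ) ξ₀
      rw [norm_sub_rev (t • τ) (t • ξ)] at this
      linarith
    rw [div_mul_eq_mul_div, div_le_iff₀ (by positivity)]
    refine le_of_mul_le_mul_left ?_ ht
    calc t * (ρ / 2 * ‖ξ‖) = ρ / 2 * (t * ‖ξ‖) := by ring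
      _ ≤ (t * ‖ξ - τ‖) * (‖ξ₀‖ + ρ / 2) := by gcongr
      _ = _ := by ring

/-! ### Moderate weights -/

theorem norm_pt_le (x ξ : Rd d) : ‖pt x ξ‖ ≤ ‖x‖ + ‖ξ‖ := by
  rw [WithLp.prod_norm_eq_of_L2]
  exact Real.sqrt_le_iff.2 ⟨by positivity, by
    change ‖x‖ ^ 2 + ‖ξ‖ ^ 2 ≤ _
    nlinarith [norm_nonneg x, norm_nonneg ξ, mul_nonneg (norm_nonneg x) (norm_nonneg ξ)]⟩

theorem add_rpow_one_div_le (hs : 1 ≤ s) {a b : ℝ} (ha : 0 ≤ a) (hb : 0 ≤ b) :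
    (a + b) ^ (1 / s) ≤ a ^ (1 / s) + b ^ (1 / s) :=
  Real.rpow_add_le_add_rpow ha hb (by positivity) ((div_le_one (by linarith)).2 hs)

/-- Since `1/s ≤ 1`, the power `1/s` is subadditive, so the displacement `x - y` of the reference
points splits off as a constant factor. -/
theorem IsModerateWeight.exists_le_exp_mul (hs : 1 ≤ s) {ϑ : R2d d → ℝ}
    (hϑ : IsModerateWeight s ϑ) (x y : Rd d) : ∃ C k : ℝ, 0 ≤ C ∧ 0 ≤ k ∧ ∀ ξ τ : Rd d,
      ϑ (pt x ξ) ≤ C * Real.exp (k * ‖ξ - τ‖ ^ (1 / s)) * ϑ (pt y τ) := by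
  obtain ⟨_, hpos, v, hv, _, ⟨C, k, hC, hk, hvb⟩, c, hc, hmod⟩ := hϑ
  refine ⟨c * (C * Real.exp (k * ‖x - y‖ ^ (1 / s))), k, by positivity, hk.le, fun ξ τ => ?_⟩
  have e : pt x ξ = pt (x - y) (ξ - τ) + pt y τ := by
    rw [← WithLp.toLp_add, Prod.mk_add_mk, sub_add_cancel, sub_add_cancel]
  have h1 : ‖pt (x - y) (ξ - τ)‖ ^ (1 / s) ≤ ‖x - y‖ ^ (1 / s) + ‖ξ - τ‖ ^ (1 / s) :=
    (Real.rpow_le_rpow (norm_nonneg _) (norm_pt_le _ _) (by positivity)).trans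
      (add_rpow_one_div_le hs (norm_nonneg _) (norm_nonneg _))
  have h2 := hpos (pt y τ)
  rw [e]
  calc _ ≤ c * (v (pt (x - y) (ξ - τ)) * ϑ (pt y τ)) := hmod _ _
    _ ≤ c * ((C * Real.exp (k * (‖x - y‖ ^ (1 / s) + ‖ξ - τ‖ ^ (1 / s)))) * ϑ (pt y τ)) := by
        gcongr
        exact (hvb _).trans (by gcongr)
    _ = _ := by rw [mul_add, Real.exp_add]; ring

end UltraWF

namespace UltraWF

variable {d : ℕ} {s : ℝ}

/-! ### The microlocal estimate -/

/-- The weighted kernel of the localization operator at a direction of a smaller cone is dominated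
by a rapidly decreasing kernel. -/
theorem exists_weight_mul_kernel_le (hs : 1 ≤ s) {ω ϑ : R2d d → ℝ} (hω : IsModerateWeight s ω)
    (hϑ : IsModerateWeight s ϑ)
    (hωϑ : ∃ c : ℝ, 0 < c ∧ ∀ x ξ : Rd d, ω (pt x ξ) ≤ c * ϑ (pt x ξ)) (x y : Rd d)
    {Γ Γ' : Set (Rd d)} {δ : ℝ} (hδ : 0 < δ) (hΓ : ∀ ξ ∈ Γ', ∀ τ ∉ Γ, δ * ‖ξ‖ ≤ ‖ξ - τ‖)
    {U : Rd d → ℝ} (hU0 : ∀ τ, 0 ≤ U τ) {C₀ k₀ : ℝ} (hC₀ : 0 ≤ C₀) (hk₀ : 0 ≤ k₀)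
    (hU : ∀ τ, U τ ≤ C₀ * Real.exp (k₀ * ‖τ‖ ^ (1 / s))) :
    ∃ N B : ℝ, 0 < N ∧ 0 ≤ B ∧ ∀ ξ ∈ Γ', ∀ τ : Rd d,
      ω (pt x ξ) * (Real.exp (-(N * ‖ξ - τ‖ ^ (1 / s))) * U τ) ≤
        B * (Real.exp (-(1 * ‖ξ - τ‖ ^ (1 / s))) *
          (Γ.indicator (fun τ => U τ * ϑ (pt y τ)) τ + Real.exp (-(1 * ‖τ‖ ^ (1 / s))))) := by
  obtain ⟨c, hc, hle⟩ := hωϑ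
  obtain ⟨C₁, k₁, hC₁, hk₁, h₁⟩ := hϑ.exists_le_exp_mul hs x y
  obtain ⟨C₂, k₂, hC₂, hk₂, h₂⟩ := hω.exists_le_exp_mul hs x x
  have hω0 := hω.2.1
  have hϑ0 := hϑ.2.1
  set a : ℝ := (1 / δ) ^ (1 / s)
  have ha : 0 ≤ a := by positivity
  -- For `τ ∈ Γ` the part `k₁ + 1` suffices. For `τ ∉ Γ`, with `m = ‖ξ - τ‖^{1/s}`, separation gives
  -- `‖ξ‖^{1/s} ≤ a m` and `‖τ‖^{1/s} ≤ (1 + a) m`: `k₂ a` pays for `ω`, and `(k₀ + 1)(1 + a)` pays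
  -- for `U` and for the additional decay in `τ`.
  set N : ℝ := k₁ + 1 + (k₂ * a + (k₀ + 1) * (1 + a))
  have hNpos : 0 < N := by positivity
  -- Comparison of `ω(x, ξ)` with `ω(x, 0)` bounds it by `D e^{k₂‖ξ‖^{1/s}}`.
  set D := C₂ * ω (pt x 0)
  have hD : 0 ≤ D := mul_nonneg hC₂ (hω0 _)
  refine ⟨N, c * C₁ + D * C₀, hNpos, by positivity, fun ξ hξ τ => ?_⟩
  set m := ‖ξ - τ‖ ^ (1 / s)
  have hm : 0 ≤ m := by positivity
  by_cases hτ : τ ∈ Γ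
  · rw [indicator_of_mem hτ]
    have hθ := mul_nonneg (hU0 τ) (hϑ0 (pt y τ))
    have hN : k₁ * m + -(N * m) ≤ -(1 * m) := by
      have : 0 ≤ (k₂ * a + (k₀ + 1) * (1 + a)) * m := by positivity
      simp only [N]
      linarith
    calc _ ≤ (c * (C₁ * Real.exp (k₁ * m) * ϑ (pt y τ))) * (Real.exp (-(N * m)) * U τ) := by
          have := hU0 τ
          gcongr
          exact (hle x ξ).trans (by gcongr; exact h₁ ξ τ)
      _ = c * C₁ * (Real.exp (k₁ * m + -(N * m)) * (U τ * ϑ (pt y τ))) := by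
          rw [Real.exp_add]
          ring
      _ ≤ _ := by
          gcongr
          · exact le_add_of_nonneg_right (by positivity)
          · exact le_add_of_nonneg_right (Real.exp_pos _).le
  · rw [indicator_of_notMem hτ, zero_add]
    have h3 : ‖ξ‖ ^ (1 / s) ≤ a * m := by
      rw [← Real.mul_rpow (by positivity) (norm_nonneg _)]
      refine Real.rpow_le_rpow (norm_nonneg _) ?_ (by positivity)
      rw [one_div_mul_eq_div, le_div_iff₀ hδ, mul_comm]
      exact hΓ ξ hξ τ hτ
    have h4 : ‖τ‖ ^ (1 / s) ≤ (1 + a) * m := by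
      have : ‖τ‖ ≤ ‖ξ‖ + ‖ξ - τ‖ := norm_le_norm_add_norm_sub ξ τ
      calc _ ≤ (‖ξ‖ + ‖ξ - τ‖) ^ (1 / s) := by gcongr
        _ ≤ ‖ξ‖ ^ (1 / s) + m := add_rpow_one_div_le hs (norm_nonneg _) (norm_nonneg _)
        _ ≤ _ := by linarith
    have h5 : k₂ * ‖ξ‖ ^ (1 / s) ≤ k₂ * (a * m) := by gcongr
    have h6 : (k₀ + 1) * ‖τ‖ ^ (1 / s) ≤ (k₀ + 1) * ((1 + a) * m) := by gcongr
    have h7 : ω (pt x ξ) ≤ D * Real.exp (k₂ * ‖ξ‖ ^ (1 / s)) := by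
      refine (h₂ ξ 0).trans_eq ?_
      rw [sub_zero]
      ring
    have hN : k₂ * ‖ξ‖ ^ (1 / s) + -(N * m) + k₀ * ‖τ‖ ^ (1 / s) ≤
        -(1 * m) + -(1 * ‖τ‖ ^ (1 / s)) := by
      have : 0 ≤ k₁ * m := by positivity
      simp only [N]
      linarith
    calc _ ≤ (D * Real.exp (k₂ * ‖ξ‖ ^ (1 / s))) * (Real.exp (-(N * m)) *
            (C₀ * Real.exp (k₀ * ‖τ‖ ^ (1 / s)))) := by
          have := hU0 τ
          gcongr
          exact hU τ
      _ = D * C₀ * Real.exp (k₂ * ‖ξ‖ ^ (1 / s) + -(N * m) + k₀ * ‖τ‖ ^ (1 / s)) := by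
          rw [Real.exp_add, Real.exp_add]
          ring
      _ ≤ (c * C₁ + D * C₀) * Real.exp (-(1 * m) + -(1 * ‖τ‖ ^ (1 / s))) := by
          gcongr
          exact le_add_of_nonneg_left (by positivity)
      _ = _ := by rw [Real.exp_add]

theorem measurable_exp_neg_norm_rpow (hs : 0 < s) (ε : ℝ) :
    Measurable fun x : Rd d => ENNReal.ofReal (Real.exp (-(ε * ‖x‖ ^ (1 / s)))) := by
  refine (ENNReal.continuous_ofReal.comp (Real.continuous_exp.comp
    (continuous_const.mul ?_).neg)).measurable
  exact continuous_norm.rpow_const fun _ => Or.inr (by positivity)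

theorem ofReal_exp_neg_norm_rpow_le_one {ε : ℝ} (hε : 0 ≤ ε) (x : Rd d) :
    ENNReal.ofReal (Real.exp (-(ε * ‖x‖ ^ (1 / s)))) ≤ 1 := by
  rw [← ENNReal.ofReal_one]
  refine ENNReal.ofReal_le_ofReal (Real.exp_le_one_iff.2 ?_)
  have : 0 ≤ ε * ‖x‖ ^ (1 / s) := by positivity
  linarith

theorem lintegral_exp_neg_norm_rpow_lt_top (hs : 0 < s) {ε : ℝ} (hε : 0 < ε) :
    ∫⁻ x : Rd d, ENNReal.ofReal (Real.exp (-(ε * ‖x‖ ^ (1 / s)))) < ⊤ :=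
  (integrable_exp_neg_norm_rpow hs hε).lintegral_lt_top

/-- Localization by a test function does not create new singular directions, and the exponent of
integrability may be increased and the weight decreased. -/
theorem regularDirections_subset_of_eq_mul [hs : Fact (1 < s)] {q r : ℝ≥0∞} (hr : 1 ≤ r)
    (hrq : r ≤ q) {ω ϑ : R2d d → ℝ} (hω : IsModerateWeight s ω) (hϑ : IsModerateWeight s ϑ)
    (hωϑ : ∃ c : ℝ, 0 < c ∧ ∀ x ξ : Rd d, ω (pt x ξ) ≤ c * ϑ (pt x ξ)) (x y : Rd d)
    {X : Set (Rd d)} (η : testSpace d s X) {u v : CompactUltradistribution d s}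
    (huv : ∀ (g : smoothSpace d s) (h : (η : Rd d → ℂ) * (g : Rd d → ℂ) ∈ smoothSpace d s),
      v.toLin g = u.toLin ⟨(η : Rd d → ℂ) * (g : Rd d → ℂ), h⟩) :
    regularDirections r ϑ y u ⊆ regularDirections q ω x v := by
  rintro ξ₀ ⟨hξ₀, Γ, hΓ, hξ₀Γ, hfin⟩
  have hs1 : 1 ≤ s := hs.out.le
  have hs0 : 0 < s := by linarith
  obtain ⟨Γ', hΓ', hξ₀Γ', δ, hδ, hsep⟩ := hΓ.exists_subcone hξ₀Γ
  refine ⟨hξ₀, Γ', hΓ', hξ₀Γ', ?_⟩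
  set κ : ℝ := (2 * Real.pi) ^ (-(d : ℝ) / 2)
  have hκ : 0 < κ := Real.rpow_pos_of_pos (by positivity) _
  have hfour : ∀ (w : CompactUltradistribution d s) (ξ : Rd d),
      ‖ultraFourier w ξ‖ = κ * ‖w.toLin (expElt hs1 ξ)‖ := by
    intro w ξ
    rw [ultraFourier, norm_mul, Complex.norm_real, Real.norm_of_nonneg hκ.le]
    rfl
  obtain ⟨C₀, k₀, hC₀, hk₀, hU⟩ := norm_apply_expElt_le hs1 u
  obtain ⟨N, B, hN, hB, hker⟩ := exists_weight_mul_kernel_le hs1 hω hϑ hωϑ x y hδ hsep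
    (U := fun τ => κ * ‖u.toLin (expElt hs1 τ)‖) (C₀ := κ * C₀) (k₀ := k₀)
    (fun τ => by positivity) (by positivity) hk₀ (fun τ => by
      rw [mul_assoc]
      gcongr
      exact hU τ)
  obtain ⟨C, hC⟩ := exists_enorm_apply_mul_expFun_le hs1 u η.2 hN
  set G : Rd d → ℝ≥0∞ := fun τ => ENNReal.ofReal (Real.exp (-(1 * ‖τ‖ ^ (1 / s))))
  set W : Rd d → ℂ := fun τ => ultraFourier u τ * ((ϑ (pt y τ) : ℝ) : ℂ)
  have hWm : Measurable W := by
    refine Measurable.mul (measurable_const.mul (continuous_apply_expElt hs1 u).measurable) ?_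
    refine Complex.measurable_ofReal.comp (hϑ.1.comp ?_)
    exact (WithLp.measurable_toLp 2 (Rd d × Rd d)).comp measurable_prodMk_left
  -- The first summand is in `L^r` by regularity of the direction; the second dominates everything
  -- coming from outside `Γ` and, being bounded and integrable, is also in `L^r`.
  set F : Rd d → ℝ≥0∞ := Γ.indicator (fun τ => ‖W τ‖ₑ) + G
  have hGm : Measurable G := measurable_exp_neg_norm_rpow hs0 1
  have hG1 : ∀ τ, G τ ≤ 1 := ofReal_exp_neg_norm_rpow_le_one zero_le_one
  have hGi : ∫⁻ τ, G τ < ⊤ := lintegral_exp_neg_norm_rpow_lt_top hs0 one_pos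
  have hΓm := hΓ.1.measurableSet
  have hFm : Measurable F := (hWm.enorm.indicator hΓm).add hGm
  have hFr : eLpNorm F r volume < ⊤ := by
    refine (eLpNorm_add_le (hWm.enorm.indicator hΓm).aestronglyMeasurable
      hGm.aestronglyMeasurable hr).trans_lt (ENNReal.add_lt_top.2 ⟨?_, ?_⟩)
    · rw [eLpNorm_indicator_eq_eLpNorm_restrict hΓm, eLpNorm_enorm]
      exact hfin
    · exact eLpNorm_lt_top_of_le_of_lintegral_lt_top ENNReal.one_ne_top hG1 one_pos
        (by simpa using hGi) (by simpa using hr)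
  have hconv := eLpNorm_convolution_lt_top hGm hFm ENNReal.one_ne_top hG1 hGi.ne hr hrq hFr
  have hpt : ∀ ξ ∈ Γ', ‖ultraFourier v ξ * ((ω (pt x ξ) : ℝ) : ℂ)‖ₑ ≤
      (C * B.toNNReal) * ‖∫⁻ τ, G (ξ - τ) * F τ‖ₑ := by
    intro ξ hξ
    have hmem : (η : Rd d → ℂ) * expFun ξ ∈ smoothSpace d s :=
      testSpace_le_smoothSpace d s univ (mul_mem_testSpace hs0.le (subset_univ X) η.2
        (expFun_mem_smoothSpace hs1 ξ))
    have e1 : ‖ultraFourier v ξ * ((ω (pt x ξ) : ℝ) : ℂ)‖ₑ =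
        ENNReal.ofReal (ω (pt x ξ) * κ) *
          ‖u.toLin ⟨(η : Rd d → ℂ) * expFun ξ, hmem⟩‖ₑ := by
      have ev : v.toLin (expElt hs1 ξ) = u.toLin ⟨(η : Rd d → ℂ) * expFun ξ, hmem⟩ :=
        huv (expElt hs1 ξ) hmem
      rw [← ev, ← ofReal_norm, ← ofReal_norm,
        ← ENNReal.ofReal_mul (mul_nonneg (hω.2.1 _) hκ.le), norm_mul, hfour, Complex.norm_real,
        Real.norm_of_nonneg (hω.2.1 _)]
      congr 1
      ring
    rw [e1, enorm_eq_self]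
    calc _ ≤ ENNReal.ofReal (ω (pt x ξ) * κ) *
          (C * ∫⁻ τ, ENNReal.ofReal (Real.exp (-(N * ‖ξ - τ‖ ^ (1 / s)))) *
            ‖u.toLin (expElt hs1 τ)‖ₑ) := by
          gcongr
          exact hC ξ hmem
      _ = C * ∫⁻ τ, ENNReal.ofReal (ω (pt x ξ) * κ) *
            (ENNReal.ofReal (Real.exp (-(N * ‖ξ - τ‖ ^ (1 / s)))) *
            ‖u.toLin (expElt hs1 τ)‖ₑ) := by
          rw [lintegral_const_mul' _ _ ENNReal.ofReal_ne_top, mul_left_comm]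
      _ ≤ C * ∫⁻ τ, B.toNNReal * (G (ξ - τ) * F τ) := by
          gcongr C * ?_
          refine lintegral_mono fun τ => ?_
          have hF : F τ = ENNReal.ofReal (Γ.indicator
              (fun τ => κ * ‖u.toLin (expElt hs1 τ)‖ * ϑ (pt y τ)) τ +
              Real.exp (-(1 * ‖τ‖ ^ (1 / s)))) := by
            have hW : ‖W τ‖ₑ =
                ENNReal.ofReal (κ * ‖u.toLin (expElt hs1 τ)‖ * ϑ (pt y τ)) := by
              rw [← ofReal_norm, norm_mul, hfour, Complex.norm_real,
                Real.norm_of_nonneg (hϑ.2.1 _)]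
            rw [ENNReal.ofReal_add (indicator_nonneg (fun τ _ =>
              mul_nonneg (by positivity) (hϑ.2.1 _)) τ) (Real.exp_pos _).le]
            by_cases hτ : τ ∈ Γ
            · simp only [F, G, Pi.add_apply, indicator_of_mem hτ, hW]
            · simp only [F, G, Pi.add_apply, indicator_of_notMem hτ, ENNReal.ofReal_zero]
          have h1 := ENNReal.ofReal_le_ofReal (hker ξ hξ τ)
          rw [hF, ← ENNReal.ofReal_mul (Real.exp_pos _).le, ← ofReal_norm,
            ← ENNReal.ofReal_mul (Real.exp_pos _).le,
            ← ENNReal.ofReal_mul (mul_nonneg (hω.2.1 _) hκ.le)]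
          change _ ≤ ENNReal.ofReal B * _
          rw [← ENNReal.ofReal_mul hB]
          refine le_trans (le_of_eq ?_) h1
          congr 1
          ring
      _ = _ := by
          rw [lintegral_const_mul' _ _ ENNReal.coe_ne_top, mul_assoc]
  unfold coneSeminorm
  refine lt_of_le_of_lt (eLpNorm_le_mul_eLpNorm_of_ae_le_mul' (c := C * B.toNNReal)
    (g := fun ξ => ∫⁻ τ, G (ξ - τ) * F τ) ?_ q) ?_
  · refine ae_restrict_of_forall_mem hΓ'.1.measurableSet fun ξ hξ => ?_
    rw [ENNReal.coe_mul]
    exact hpt ξ hξ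
  · exact ENNReal.mul_lt_top ENNReal.coe_lt_top
      ((eLpNorm_mono_measure _ Measure.restrict_le_self).trans_lt hconv)

/-! ### From regular directions to wave-front sets -/

theorem localize_mulUltra_apply [Fact (1 < s)] {X Y : Set (Rd d)} (ψ : testSpace d s X)
    (φ : testSpace d s Y) (f : Ultradistribution d s) (g : smoothSpace d s)
    (h : (φ : Rd d → ℂ) * (g : Rd d → ℂ) ∈ smoothSpace d s) :
    (localize ψ (mulUltra φ f)).toLin g =
      (localize ψ f).toLin ⟨(φ : Rd d → ℂ) * (g : Rd d → ℂ), h⟩ := by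
  change f.toLin (mulLin φ _) = f.toLin (mulLin ψ _)
  congr 1
  exact Subtype.ext (mul_left_comm (φ : Rd d → ℂ) (ψ : Rd d → ℂ) (g : Rd d → ℂ))

end UltraWF

open UltraWF
theorem theorem2p2 {d : ℕ} {s : ℝ} [Fact (1 < s)] (q r : ℝ≥0∞) (hq : 1 ≤ q) (hr : 1 ≤ r)
    (hrq : r ≤ q) (X : Set (Rd d)) (hX : IsOpen X) (ω ϑ : R2d d → ℝ)
    (hω : IsModerateWeight s ω) (hϑ : IsModerateWeight s ϑ)
    (hωϑ : ∃ c : ℝ, 0 < c ∧ ∀ x ξ : Rd d, ω (pt x ξ) ≤ c * ϑ (pt x ξ))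
    (f : Ultradistribution d s) (x y : Rd d) :
    (∀ φ : testSpace d s X, waveFrontSet q ω x X (mulUltra φ f) ⊆ waveFrontSet r ϑ y X f) ∧
      waveFrontSet q ω x X f ⊆ waveFrontSet r ϑ y X f := by
  have hs : (0 : ℝ) ≤ s := zero_le_one.trans (Fact.out : 1 < s).le
  refine ⟨fun φ => ?_, ?_⟩
  · rintro ⟨x₀, ξ₀⟩ ⟨hx₀, hξ₀, h⟩
    refine ⟨hx₀, hξ₀, fun ψ hψ => ⟨hξ₀, fun hreg => (h ψ hψ).2 ?_⟩⟩
    -- By contraposition, with `u = ψ f` and `v = ψ(φ f) = φ u`: the cutoff `ψ` that makes `ξ₀`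
    -- regular for `f` also does so for `φ f`.
    exact regularDirections_subset_of_eq_mul hr hrq hω hϑ hωϑ x y φ
      (localize_mulUltra_apply ψ φ f) hreg
  · rintro ⟨x₀, ξ₀⟩ ⟨hx₀, hξ₀, h⟩
    refine ⟨hx₀, hξ₀, fun ψ hψ => ⟨hξ₀, fun hreg => ?_⟩⟩
    -- The square of the cutoff: `χ f = ψ(ψ f)` provides the second localization, needed because
    -- `L^r` on a cone does not embed in `L^q` without a convolution, and `χ(x₀) = ψ(x₀)² ≠ 0`.
    let χ : testSpace d s X := ⟨(ψ : Rd d → ℂ) * (ψ : Rd d → ℂ),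
      mul_mem_testSpace hs subset_rfl ψ.2 (testSpace_le_smoothSpace d s X ψ.2)⟩
    refine (h χ (mul_ne_zero hψ hψ)).2 ?_
    refine regularDirections_subset_of_eq_mul hr hrq hω hϑ hωϑ x y ψ (fun g hg => ?_) hreg
    change f.toLin (mulLin χ _) = f.toLin (mulLin ψ _)
    congr 1
    exact Subtype.ext (mul_assoc (ψ : Rd d → ℂ) (ψ : Rd d → ℂ) (g : Rd d → ℂ))
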